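/- Let $p$ be a prime and $k$ an algebraically closed field of characteristic $p$, with $W=W(k)$ and Frobenius $\sigma$ on $W$. Let $$A=W[F,V]/(FV-p,\;VF-p,\;Fa-a^{\sigma}F,\;aV-Va^{\sigma}\ (a\in W)),\qquad M_3=(A/A(F-V))^4,$$ with skeleton $x_1,\dots,x_4$ (the standard generators, so $Fx_i=Vx_i$). Equip $M_3$ with the alternating $W$-bilinear quasi-polarization with values in $\mathrm{Frac}(W)$ that satisfies $\langle x,Fy\rangle=\langle Vx,y\rangle^{\sigma}$, $\langle x_1,F^4x_4\rangle=\langle x_2,F^4x_3\rangle=1$, and for which the other products $\langle x_i,x_j\rangle$ ($i<j$) and all $\langle x_i,Fx_j\rangle$ are zero; write $N^t$ for the dual of a lattice $N$, so that $M_3^t=F^3M_3$. A polarized Dieudonné flag of length $4$ is a chain of $W$-submodules $M_0\subset M_1\subset M_2\subset M_3$ with $(F,V)M_i\subset M_{i-1}$ and $\dim_k(M_i/M_{i-1})=i$ for $i=1,2,3$, and $(F,V)^iM_i\subset M_i^t$ for $i=0,\dots,3$. It is rigid if $M_i=M_0+F^{3-i}M_3$ for $i=0,\dots,3$. The smooth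 model $\mathcal F_0$ of an irreducible component of the supersingular locus $S_4\subset\mathcal A_4\otimes\mathbb F_p$ is the Zariski closure of the moduli space of rigid polarized Dieudonné flags of length $4$, where $M_1$ is presented modulo $FM_2$ by two generators $v,w$ with $w\in FM_3$. That is, the closure is taken in the space of polarized flags together with a submodule $L=Ww+FM_2$ such that $FM_2\subset L\subset M_1\cap FM_3$ and $\dim_k L/FM_2=1$, into which a rigid flag is embedded by its unique such $L$, namely $L=M_1\cap FM_3$. Give $\mathcal F_0$ the $\mathbb F_{p^2}$-structure defined by the skeleton: a $k$-point is rational over $\mathbb F_{p^2}$ if and only if $M_0,\dots,M_3$ and $L$ are all mapped onto themselves by the $\sigma^2$-linear bijection $\Phi=p^{-1}F^2$ of $M_3$ (which fixes $x_1,\dots,x_4$). Then $$\#\mathcal F_0(\mathbb F_{p^2})=(p^2+1)^3(p^3+1)(p^4+1).$$ -/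

import Mathlib

noncomputable section

namespace FlagType

variable (p : ℕ) [Fact p.Prime] (k : Type*) [Field k]

/-- The Dieudonné module `M₃ = A_{1,1}⁴ = (A / A(F - V))⁴` over `W = W(k)`, with
`A = W[F, V] / (FV - p, VF - p, Fa - a^σ F, aV - V a^σ)`. It is `W`-free on the skeleton
`x₀, …, x₃` (with `F xᵢ = V xᵢ`) together with `F x₀, …, F x₃`; the pair `(α, β)` stands for
`∑ αᵢ xᵢ + ∑ βᵢ F xᵢ`. -/
abbrev M3 : Type _ := (Fin 4 → WittVector p k) × (Fin 4 → WittVector p k)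

section Perfect

variable [CharP k p] [PerfectRing k p]

/-- The Frobenius automorphism of `W(k)`. -/
abbrev sigma : WittVector p k ≃+* WittVector p k := WittVector.frobeniusEquiv p k

/-- `F`, the `σ`-linear map with `F (F xᵢ) = p xᵢ`. -/
def F : M3 p k →ₛₗ[(sigma p k : WittVector p k →+* WittVector p k)] M3 p k where
  toFun z := (fun i => (p : WittVector p k) * sigma p k (z.2 i), fun i => sigma p k (z.1 i))
  map_add' x y := by
    ext i : 2 <;> simp only [Prod.fst_add, Prod.snd_add, Pi.add_apply, map_add, mul_add]
  map_smul' c x := by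
    ext i : 2 <;>
      (simp only [Prod.smul_fst, Prod.smul_snd, Pi.smul_apply, smul_eq_mul, map_mul,
        RingHom.coe_coe]; try ring)

/-- `V`, the `σ⁻¹`-linear map with `V xᵢ = F xᵢ` and `V (F xᵢ) = p xᵢ`. -/
def V : M3 p k →ₛₗ[((sigma p k).symm : WittVector p k →+* WittVector p k)] M3 p k where
  toFun z :=
    (fun i => (p : WittVector p k) * (sigma p k).symm (z.2 i), fun i => (sigma p k).symm (z.1 i))
  map_add' x y := by
    ext i : 2 <;> simp only [Prod.fst_add, Prod.snd_add, Pi.add_apply, map_add, mul_add]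
  map_smul' c x := by
    ext i : 2 <;>
      (simp only [Prod.smul_fst, Prod.smul_snd, Pi.smul_apply, smul_eq_mul, map_mul,
        RingHom.coe_coe]; try ring)

/-- The `σ²`-linear bijection of `M₃` fixing the skeleton. It gives the `𝔽_{p²}`-structure:
a `k`-point of the moduli spaces below is moved by the `p²`-power Frobenius by moving all
modules of the flag along this map. -/
def Phi : M3 p k →ₛₗ[((sigma p k).trans (sigma p k) : WittVector p k →+* WittVector p k)]
    M3 p k where
  toFun z := (fun i => sigma p k (sigma p k (z.1 i)), fun i => sigma p k (sigma p k (z.2 i)))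
  map_add' x y := by
    ext i : 2 <;> simp only [Prod.fst_add, Prod.snd_add, Pi.add_apply, map_add]
  map_smul' c x := by
    ext i : 2 <;>
      simp only [Prod.smul_fst, Prod.smul_snd, Pi.smul_apply, smul_eq_mul, map_mul,
        RingHom.coe_coe, RingEquiv.coe_trans, Function.comp_apply]

theorem F_V (z : M3 p k) : F p k (V p k z) = (p : WittVector p k) • z := by
  ext i : 2
  · change (p : WittVector p k) * sigma p k ((sigma p k).symm (z.1 i)) = p * z.1 i
    rw [RingEquiv.apply_symm_apply]
  · change sigma p k ((p : WittVector p k) * (sigma p k).symm (z.2 i)) = p * z.2 i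
    rw [map_mul, map_natCast, RingEquiv.apply_symm_apply]

theorem V_F (z : M3 p k) : V p k (F p k z) = (p : WittVector p k) • z := by
  ext i : 2
  · change (p : WittVector p k) * (sigma p k).symm (sigma p k (z.1 i)) = p * z.1 i
    rw [RingEquiv.symm_apply_apply]
  · change (sigma p k).symm ((p : WittVector p k) * sigma p k (z.2 i)) = p * z.2 i
    rw [map_mul, map_natCast, RingEquiv.symm_apply_apply]

theorem F_F (z : M3 p k) : F p k (F p k z) = (p : WittVector p k) • Phi p k z := by
  ext i : 2
  · rfl
  · simp only [F, LinearMap.coe_mk, AddHom.coe_mk, map_mul, map_natCast]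
    rfl

/-- The submodule `(F, V) N = F N + V N`. -/
def FV (N : Submodule (WittVector p k) (M3 p k)) : Submodule (WittVector p k) (M3 p k) :=
  N.map (F p k) ⊔ N.map (V p k)

/-- The submodule `Fⁿ M₃`. -/
def FPow (n : ℕ) : Submodule (WittVector p k) (M3 p k) :=
  (Submodule.map (F p k))^[n] ⊤

end Perfect

/-- The standard alternating form `a₀b₃ - a₃b₀ + a₁b₂ - a₂b₁`. -/
def alt {R : Type*} [CommRing R] (a b : Fin 4 → R) : R :=
  a 0 * b 3 - a 3 * b 0 + a 1 * b 2 - a 2 * b 1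

section Pairing

variable [CharP k p]

/-- The quasi-polarization `⟨ , ⟩ : M₃ × M₃ → Frac W`: the alternating `W`-bilinear form with
`⟨x, F y⟩ = ⟨V x, y⟩^σ`, with `⟨x₀, F⁴ x₃⟩ = ⟨x₁, F⁴ x₂⟩ = 1`, and
such that the other products `⟨xᵢ, xⱼ⟩`, `i < j`, and all the `⟨xᵢ, F xⱼ⟩` vanish. As `F⁴ = p²`
on the skeleton, `⟨x₀, x₃⟩ = ⟨x₁, x₂⟩ = p⁻²` and `⟨F x₀, F x₃⟩ = ⟨F x₁, F x₂⟩ = p⁻¹`. -/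
def pairing (x y : M3 p k) : FractionRing (WittVector p k) :=
  algebraMap (WittVector p k) (FractionRing (WittVector p k)) (alt x.1 y.1) /
      (p : FractionRing (WittVector p k)) ^ 2 +
    algebraMap (WittVector p k) (FractionRing (WittVector p k)) (alt x.2 y.2) /
      (p : FractionRing (WittVector p k))

theorem pairing_add_right (x y z : M3 p k) :
    pairing p k x (y + z) = pairing p k x y + pairing p k x z := by
  simp only [pairing, alt, Prod.fst_add, Prod.snd_add, Pi.add_apply, map_add, map_sub, map_mul]
  ring

theorem pairing_smul_right (c : WittVector p k) (x y : M3 p k) :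
    pairing p k x (c • y) = algebraMap _ _ c * pairing p k x y := by
  simp only [pairing, alt, Prod.smul_fst, Prod.smul_snd, Pi.smul_apply, smul_eq_mul, map_add,
    map_sub, map_mul]
  ring

/-- The dual `Nᵗ = {y | ⟨x, y⟩ ∈ W for all x ∈ N}`. It is formed inside `M₃`, which contains
the dual of every `N ⊇ F³ M₃`, because `M₃ᵗ = F³ M₃`; all modules in the flags below
contain `F³ M₃`. -/
def dual (N : Submodule (WittVector p k) (M3 p k)) : Submodule (WittVector p k) (M3 p k) where
  carrier := {y | ∀ x ∈ N, pairing p k x y ∈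
    (algebraMap (WittVector p k) (FractionRing (WittVector p k))).range}
  add_mem' {y z} hy hz x hx := by
    rw [pairing_add_right]
    exact add_mem (hy x hx) (hz x hx)
  zero_mem' x _ := by
    have h : pairing p k x 0 = 0 := by simp [pairing, alt]
    rw [h]
    exact zero_mem _
  smul_mem' c y hy x hx := by
    rw [pairing_smul_right]
    exact mul_mem ⟨c, rfl⟩ (hy x hx)

end Pairing

/-- The length of `N / N'` for submodules `N' ≤ N` of `M₃`. -/
def relLength (N' N : Submodule (WittVector p k) (M3 p k)) : ℕ∞ :=
  Module.length (WittVector p k) (N ⧸ N'.submoduleOf N)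

section Flags

variable [CharP k p] [PerfectRing k p]

/-- A polarized Dieudonné flag `M₀ ⊂ M₁ ⊂ M₂ ⊂ M₃` of length 4 over `k`, with the fixed
quasi-polarization on `M₃`. -/
structure PolarizedFlag where
  M : Fin 4 → Submodule (WittVector p k) (M3 p k)
  top : M 3 = ⊤
  le (i : Fin 3) : M i.castSucc ≤ M i.succ
  FV_le (i : Fin 3) : FV p k (M i.succ) ≤ M i.castSucc
  length_eq (i : Fin 3) : relLength p k (M i.castSucc) (M i.succ) = (i : ℕ) + 1
  FV_pow_le (i : Fin 4) : (FV p k)^[(i : ℕ)] (M i) ≤ dual p k (M i)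

/-- The flag is rigid: `Mᵢ = M₀ + F^{3-i} M₃` for `i = 0, …, 3`. -/
def PolarizedFlag.IsRigid {p : ℕ} [Fact p.Prime] {k : Type*} [Field k] [CharP k p]
    [PerfectRing k p] (x : PolarizedFlag p k) : Prop :=
  ∀ i : Fin 4, x.M i = x.M 0 ⊔ FPow p k (3 - (i : ℕ))

/-- A polarized Dieudonné flag with a presentation of `M₁` by generators `v, w` modulo `F M₂`,
where `w` lies in `F M₃`. What matters of `w` is the module `L = W w + F M₂`, that is, a line
`L / F M₂` in `(M₁ ∩ F M₃) / F M₂`. If the flag is rigid then `L = M₁ ∩ F M₃`, so a rigid flag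
carries exactly one such `L`. -/
structure MarkedFlag extends PolarizedFlag p k where
  L : Submodule (WittVector p k) (M3 p k)
  map_le_L : (M 2).map (F p k) ≤ L
  L_le : L ≤ M 1 ⊓ FPow p k 1
  length_L : relLength p k ((M 2).map (F p k)) L = 1

/-- The coordinates of the class of `z` in `M₃ / F³ M₃ ≅ k¹²`: the Witt components of `αᵢ`
modulo `p²` and of `βᵢ` modulo `p`. -/
def coords (z : M3 p k) : Fin 4 × Fin 3 → k :=
  fun ij => ![(z.1 ij.1).coeff 0, (z.2 ij.1).coeff 0, (z.1 ij.1).coeff 1] ij.2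

/-- Four elements `v₀, w, v, u` of `M₃` (that is, `b 0, b 1, b 2, b 3`) present a marked flag:
`M₂ = W v₀ + F M₃`, `L = W w + F M₂`, `M₁ = W v + L`, `M₀ = W u + M₁ᵗ`. -/
structure Presents (b : Fin 4 → M3 p k) (x : MarkedFlag p k) : Prop where
  M_two : x.M 2 = Submodule.span _ {b 0} ⊔ FPow p k 1
  L_eq : x.L = Submodule.span _ {b 1} ⊔ (x.M 2).map (F p k)
  M_one : x.M 1 = Submodule.span _ {b 2} ⊔ x.L
  M_zero : x.M 0 = Submodule.span _ {b 3} ⊔ dual p k (x.M 1)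

/-- The set, in the affine space `k⁴⁸ = (M₃ / F³ M₃)⁴`, of all presentations of members
of `S`. -/
def presentations (S : Set (MarkedFlag p k)) : Set (Fin 4 × (Fin 4 × Fin 3) → k) :=
  {c | ∃ x ∈ S, ∃ b : Fin 4 → M3 p k, Presents p k b x ∧ c = fun ij => coords p k (b ij.1) ij.2}

/-- The Zariski closure of a set `S` of marked flags. The moduli space of marked flags has the
quotient topology from the space of presentations (the map that forgets the presentation is
open and surjective), so `x` is in the closure of `S` if and only if all its presentations are
in the Zariski closure of the set of presentations of members of `S`. -/
def zariskiClosure (S : Set (MarkedFlag p k)) : Set (MarkedFlag p k) :=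
  {x | presentations p k {x} ⊆
    MvPolynomial.zeroLocus k (MvPolynomial.vanishingIdeal k (presentations p k S))}

/-- The `k`-points of the smooth model `𝓕₀`: the Zariski closure of the moduli of rigid
polarized Dieudonné flags. -/
def F0 : Set (MarkedFlag p k) :=
  zariskiClosure p k {x | x.toPolarizedFlag.IsRigid}

/-- `x` is fixed by the `p²`-power Frobenius, that is, rational over `𝔽_{p²}`. -/
def MarkedFlag.IsRational {p : ℕ} [Fact p.Prime] {k : Type*} [Field k] [CharP k p]
    [PerfectRing k p] (x : MarkedFlag p k) : Prop :=
  (∀ i, (x.M i).map (Phi p k) = x.M i) ∧ x.L.map (Phi p k) = x.L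

end Flags

end FlagType

end

/-! A rational flag is determined by `M₂`, `L`, `M₁`, `M₀`, chosen in this order. At each stage the
number of choices does not depend on the earlier ones, so the count is a product of four factors.
Put q = p².

The choices of `M₂` are the rational lines in `M₃ / F M₃`, which has dimension 4: 1 + q + q² + q³ =
(p² + 1)(p⁴ + 1) of them (`ncard_M2`). On the closure `L` lies in `rad M₂`. If a spans `M₂` modulo
`F M₃` and s is its Frobenius twist, then `rad M₂ / F M₂` is the plane s^⊥ / s, which has q + 1
rational lines (`Frame.ncard_L`). Every such `L` is self-dual (`Frame.dual_L`).

For `M₁` one needs a line in the three-dimensional space `M₂ / L`. In suitable coordinates the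
condition on `F M₁` and `V M₁` is c₀ c₁^p = c₀^p c₁ (`Frame.FV_lineOver_iff`). This describes p + 1
lines of the projective plane through the point (0 : 0 : 1), which stands for `rad M₂`. The line c₀
= 0 consists of flags with `M₁ ⊂ F M₃`, which are not rigid, and the closure meets it only in that
point. There remain p lines with p² further rational points each, together p³ + 1
(`Frame.ncard_M1`). Finally `M₀` is any rational line in the plane `M₁ / M₁ᵗ`, because every line is
isotropic for an alternating form: q + 1 choices (`Frame.ncard_M0`).

The closure is treated from both sides. Two polynomial identities in the coordinates of a
presentation hold for rigid flags and hence on the closure; they yield `L ≤ rad M₂`, and `M₁ ≤ rad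
M₂` whenever `M₁ ≤ F M₃` (`MarkedFlag.IsRational.le_rad_of_mem_F0`). Conversely a rational flag with
these properties lies on an explicit polynomial curve of presentations that are rigid for all but
finitely many parameters (`Frame.mem_F0`). -/

noncomputable section

namespace FlagType

open WittVector

set_option linter.unusedSectionVars false

/-! ### Lengths and coverings of submodules of `M₃`. -/

section Length

variable {p : ℕ} [Fact p.Prime] {k : Type*} [Field k]

variable (p k) in
/-- The submodules of `M₃`. -/
abbrev Lat : Type _ := Submodule (WittVector p k) (M3 p k)

theorem relLength_self (N : Lat p k) : relLength p k N N = 0 := by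
  rw [relLength, Submodule.submoduleOf_self, Module.length_eq_zero_iff]
  exact Submodule.Quotient.subsingleton_iff.mpr rfl

theorem relLength_eq_one_iff {N' N : Lat p k} (h : N' ≤ N) : relLength p k N' N = 1 ↔ N' ⋖ N := by
  rw [relLength, Module.length_eq_one_iff, covBy_iff_quot_is_simple h]
  rfl

theorem relLength_pos {N' N : Lat p k} (h : N' < N) : relLength p k N' N ≠ 0 := by
  rw [relLength, Ne, Module.length_eq_zero_iff, Submodule.Quotient.subsingleton_iff]
  intro h'
  exact h.not_ge (Submodule.submoduleOf_eq_top.mp h')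

theorem relLength_add {N₁ N₂ N₃ : Lat p k} (h₁ : N₁ ≤ N₂) (h₂ : N₂ ≤ N₃) :
    relLength p k N₁ N₃ = relLength p k N₁ N₂ + relLength p k N₂ N₃ := by
  unfold relLength
  let f : (N₂ ⧸ N₁.submoduleOf N₂) →ₗ[WittVector p k] (N₃ ⧸ N₁.submoduleOf N₃) :=
    Submodule.mapQ _ _ (Submodule.inclusion h₂) (by
      intro x hx
      simpa [Submodule.submoduleOf] using hx)
  let g : (N₃ ⧸ N₁.submoduleOf N₃) →ₗ[WittVector p k] (N₃ ⧸ N₂.submoduleOf N₃) :=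
    Submodule.mapQ _ _ LinearMap.id (by
      intro x hx
      exact h₁ hx)
  refine Module.length_eq_add_of_exact f g ?_ ?_ ?_
  · rw [← LinearMap.ker_eq_bot, LinearMap.ker_eq_bot']
    intro m
    induction m using Submodule.Quotient.induction_on with
    | H z =>
      intro hz
      rw [Submodule.mapQ_apply, Submodule.Quotient.mk_eq_zero] at hz
      rw [Submodule.Quotient.mk_eq_zero]
      exact hz
  · intro m
    induction m using Submodule.Quotient.induction_on with
    | H z => exact ⟨Submodule.Quotient.mk z, rfl⟩
  · intro m
    induction m using Submodule.Quotient.induction_on with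
    | H z =>
      constructor
      · intro hz
        change (Submodule.Quotient.mk z : N₃ ⧸ N₂.submoduleOf N₃) = 0 at hz
        rw [Submodule.Quotient.mk_eq_zero] at hz
        exact ⟨Submodule.Quotient.mk ⟨z, hz⟩, rfl⟩
      · rintro ⟨y, hy⟩
        rw [← hy]
        induction y using Submodule.Quotient.induction_on with
        | H y =>
          change Submodule.Quotient.mk _ = _
          rw [Submodule.Quotient.mk_eq_zero]
          exact y.2

theorem eq_of_le_of_relLength {N' N : Lat p k} (h : N' ≤ N) (h0 : relLength p k N' N = 0) :
    N' = N := by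
  by_contra hne
  exact relLength_pos (lt_of_le_of_ne h hne) h0

theorem exists_mem_notMem_of_covBy {N' N : Lat p k} (h : N' ⋖ N) : ∃ z ∈ N, z ∉ N' :=
  SetLike.exists_of_lt h.lt

theorem eq_span_sup_of_covBy {N' N : Lat p k} (h : N' ⋖ N) {z : M3 p k} (hz : z ∈ N)
    (hz' : z ∉ N') : N = Submodule.span _ {z} ⊔ N' := by
  have hle : Submodule.span _ {z} ⊔ N' ≤ N :=
    sup_le ((Submodule.span_singleton_le_iff_mem _ _).mpr hz) h.le
  rcases h.eq_or_eq le_sup_right hle with h1 | h1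
  · exact absurd (h1 ▸ (le_sup_left : Submodule.span _ {z} ≤ _)
      (Submodule.mem_span_singleton_self z)) hz'
  · exact h1.symm

theorem mem_span_sup_iff {N : Lat p k} {z y : M3 p k} :
    y ∈ Submodule.span (WittVector p k) {z} ⊔ N ↔ ∃ c : WittVector p k, ∃ n ∈ N, y = c • z + n := by
  rw [Submodule.mem_sup]
  constructor
  · rintro ⟨a, ha, b, hb, rfl⟩
    obtain ⟨c, rfl⟩ := Submodule.mem_span_singleton.mp ha
    exact ⟨c, b, hb, rfl⟩
  · rintro ⟨c, n, hn, rfl⟩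
    exact ⟨_, Submodule.smul_mem _ c (Submodule.mem_span_singleton_self z), n, hn, rfl⟩

section Perfect

variable [CharP k p] [PerfectRing k p]

/-- Over a perfect field Frobenius is bijective on Witt vectors, so Verschiebung and multiplication
by p have the same image. -/
theorem coeff_zero_eq_zero_iff (x : WittVector p k) : x.coeff 0 = 0 ↔ ∃ y, x = (p : WittVector p k) * y := by
  constructor
  · intro h
    have h1 : x = verschiebung (x.shift 1) := (eq_iterate_verschiebung (n := 1) (by
        intro i hi
        obtain rfl : i = 0 := by omega
        exact h))
    obtain ⟨y, hy⟩ := (frobenius_bijective p k).2 (x.shift 1)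
    exact ⟨y, by rw [h1, ← hy, verschiebung_frobenius, mul_comm]⟩
  · rintro ⟨y, rfl⟩
    rw [mul_comm, mul_charP_coeff_zero]

theorem isUnit_iff_coeff_zero (x : WittVector p k) : IsUnit x ↔ x.coeff 0 ≠ 0 := by
  refine ⟨fun h => ?_, isUnit_of_coeff_zero_ne_zero x⟩
  exact (h.map (constantCoeff : WittVector p k →+* k)).ne_zero

theorem smul_mem_of_coeff_zero {N : Lat p k} {z : M3 p k} (hz : (p : WittVector p k) • z ∈ N)
    {c : WittVector p k} (hc : c.coeff 0 = 0) : c • z ∈ N := by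
  obtain ⟨y, rfl⟩ := (coeff_zero_eq_zero_iff c).mp hc
  rw [mul_comm, mul_smul]
  exact N.smul_mem y hz

theorem smul_mem_iff_of_notMem {N : Lat p k} {z : M3 p k} (hz : (p : WittVector p k) • z ∈ N)
    (hz' : z ∉ N) {c : WittVector p k} : c • z ∈ N ↔ c.coeff 0 = 0 := by
  refine ⟨fun h => ?_, smul_mem_of_coeff_zero hz⟩
  by_contra hc
  obtain ⟨u, rfl⟩ := isUnit_of_coeff_zero_ne_zero c hc
  exact hz' ((N.smul_mem_iff_of_isUnit u.isUnit).mp h)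

theorem covBy_span_sup {N : Lat p k} {z : M3 p k} (hz : (p : WittVector p k) • z ∈ N)
    (hz' : z ∉ N) : N ⋖ Submodule.span (WittVector p k) {z} ⊔ N := by
  refine ⟨lt_of_le_of_ne le_sup_right ?_, ?_⟩
  · intro h
    apply hz'
    rw [h]
    exact Submodule.mem_sup_left (Submodule.mem_span_singleton_self z)
  · intro X hX hX'
    obtain ⟨y, hy, hyN⟩ := SetLike.exists_of_lt hX
    obtain ⟨c, n, hn, rfl⟩ := mem_span_sup_iff.mp (hX'.le hy)
    have hc : c • z ∈ X := by
      have := X.sub_mem hy (hX.le hn)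
      rwa [add_sub_cancel_right] at this
    have hc0 : c.coeff 0 ≠ 0 := fun h => hyN (N.add_mem (smul_mem_of_coeff_zero hz h) hn)
    have hzX : z ∈ X := (X.smul_mem_iff_of_isUnit (isUnit_of_coeff_zero_ne_zero c hc0)).mp hc
    exact hX'.not_ge (sup_le ((Submodule.span_singleton_le_iff_mem _ _).mpr hzX) hX.le)

/-- Multiplication by `p` kills the quotient of a covering. -/
theorem p_smul_mem_of_covBy {N' N : Lat p k} (h : N' ⋖ N) {z : M3 p k} (hz : z ∈ N) :
    (p : WittVector p k) • z ∈ N' := by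
  by_cases hz' : z ∈ N'
  · exact N'.smul_mem _ hz'
  by_contra hp
  have h1 := eq_span_sup_of_covBy h (N.smul_mem _ hz) hp
  rw [h1] at hz
  obtain ⟨c, n, hn, hcn⟩ := mem_span_sup_iff.mp hz
  have h2 : (1 - c * p) • z = n := by
    rw [sub_smul, one_smul, mul_smul]
    exact sub_eq_of_eq_add' hcn
  -- This is Nakayama's argument: z = c p z + n, and 1 - c p is invertible because its zeroth
  -- component is 1.
  have h3 : IsUnit (1 - c * p : WittVector p k) := by
    rw [isUnit_iff_coeff_zero]
    have : (1 - c * p : WittVector p k).coeff 0 = 1 := by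
      have h4 := map_sub (constantCoeff : WittVector p k →+* k) 1 (c * p)
      simpa only [constantCoeff_apply, mul_charP_coeff_zero, one_coeff_zero, sub_zero] using h4
    rw [this]
    exact one_ne_zero
  exact hz' ((N'.smul_mem_iff_of_isUnit h3).mp (h2 ▸ hn))

/-- The `eᵢ` are linearly independent modulo `N` and `p`, and killed by `p` modulo `N`. -/
structure IndepMod {d : ℕ} (e : Fin d → M3 p k) (N : Lat p k) : Prop where
  p_smul (i : Fin d) : (p : WittVector p k) • e i ∈ N
  coeff_zero (c : Fin d → WittVector p k) (h : ∑ i, c i • e i ∈ N) (i : Fin d) : (c i).coeff 0 = 0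

theorem IndepMod.sum_mem_iff {d : ℕ} {e : Fin d → M3 p k} {N : Lat p k} (h : IndepMod e N)
    (c : Fin d → WittVector p k) : ∑ i, c i • e i ∈ N ↔ ∀ i, (c i).coeff 0 = 0 :=
  ⟨h.coeff_zero c, fun hc => N.sum_mem fun i _ => smul_mem_of_coeff_zero (h.p_smul i) (hc i)⟩

theorem relLength_sup_span : ∀ {d : ℕ} {e : Fin d → M3 p k} {N : Lat p k}, IndepMod e N →
    relLength p k N (Submodule.span _ (Set.range e) ⊔ N) = d
  | 0, e, N, _ => by
    rw [Set.range_eq_empty, Submodule.span_empty, bot_sup_eq, relLength_self]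
    rfl
  | d + 1, e, N, h => by
    have h0 : N ⋖ Submodule.span (WittVector p k) {e 0} ⊔ N := by
      refine covBy_span_sup (h.p_smul 0) fun h0 => ?_
      have := h.coeff_zero (Pi.single 0 1) (by
        rw [Finset.sum_eq_single 0]
        · simpa using h0
        · intro i _ hi; simp [hi]
        · simp) 0
      simp at this
    have h1 : IndepMod (fun i : Fin d => e i.succ) (Submodule.span (WittVector p k) {e 0} ⊔ N) := by
      refine ⟨fun i => Submodule.mem_sup_right (h.p_smul _), fun c hc i => ?_⟩
      obtain ⟨a, n, hn, hcn⟩ := mem_span_sup_iff.mp hc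
      have := h.coeff_zero (Fin.cons (-a) c) (by
        rw [Fin.sum_univ_succ]
        simp only [Fin.cons_zero, Fin.cons_succ, hcn, neg_smul, neg_add_cancel_left]
        exact hn) i.succ
      simpa using this
    have h2 := relLength_sup_span h1
    have h3 : Submodule.span (WittVector p k) (Set.range e) ⊔ N =
        Submodule.span _ (Set.range fun i : Fin d => e i.succ) ⊔
          (Submodule.span (WittVector p k) {e 0} ⊔ N) := by
      have : Set.range e = insert (e 0) (Set.range fun i : Fin d => e i.succ) := by
        ext x
        simp only [Set.mem_range, Set.mem_insert_iff, Fin.exists_fin_succ, eq_comm]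
      rw [this, Submodule.span_insert]
      ac_rfl
    rw [h3, relLength_add h0.le le_sup_right, h2, (relLength_eq_one_iff h0.le).mpr h0]
    push_cast
    rw [add_comm]

end Perfect

end Length

/-! ### Reduction modulo p and the standard alternating form. -/

variable {p : ℕ} [Fact p.Prime] {k : Type*} [Field k]

/-- Reduction modulo `p` of the coordinates with respect to the `xᵢ`. -/
def redFst : M3 p k →ₛₗ[(constantCoeff : WittVector p k →+* k)] (Fin 4 → k) where
  toFun z i := (z.1 i).coeff 0
  map_add' x y := by ext i; exact add_coeff_zero _ _
  map_smul' c x := by ext i; exact mul_coeff_zero _ _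

/-- Reduction modulo `p` of the coordinates with respect to the `F xᵢ`. -/
def redSnd : M3 p k →ₛₗ[(constantCoeff : WittVector p k →+* k)] (Fin 4 → k) where
  toFun z i := (z.2 i).coeff 0
  map_add' x y := by ext i; exact add_coeff_zero _ _
  map_smul' c x := by ext i; exact mul_coeff_zero _ _

section Alt

variable {R : Type*} [CommRing R]

theorem alt_self (a : Fin 4 → R) : alt a a = 0 := by simp only [alt]; ring

theorem alt_comm (a b : Fin 4 → R) : alt a b = -alt b a := by simp only [alt]; ring

theorem alt_add_left (a b c : Fin 4 → R) : alt (a + b) c = alt a c + alt b c := by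
  simp only [alt, Pi.add_apply]; ring

theorem alt_add_right (a b c : Fin 4 → R) : alt a (b + c) = alt a b + alt a c := by
  simp only [alt, Pi.add_apply]; ring

theorem alt_smul_left (r : R) (a b : Fin 4 → R) : alt (r • a) b = r * alt a b := by
  simp only [alt, Pi.smul_apply, smul_eq_mul]; ring

theorem alt_smul_right (r : R) (a b : Fin 4 → R) : alt a (r • b) = r * alt a b := by
  simp only [alt, Pi.smul_apply, smul_eq_mul]; ring

theorem alt_zero_left (a : Fin 4 → R) : alt 0 a = 0 := by simp [alt]

theorem alt_zero_right (a : Fin 4 → R) : alt a 0 = 0 := by simp [alt]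

theorem map_alt {S : Type*} [CommRing S] (f : R →+* S) (a b : Fin 4 → R) :
    f (alt a b) = alt (fun i => f (a i)) (fun i => f (b i)) := by simp [alt]

end Alt

theorem coeff_zero_alt (a b : Fin 4 → WittVector p k) :
    (alt a b).coeff 0 = alt (fun i => (a i).coeff 0) (fun i => (b i).coeff 0) :=
  map_alt (constantCoeff : WittVector p k →+* k) a b

section Perfect

variable [CharP k p] [PerfectRing k p]

theorem coeff_zero_sigma (x : WittVector p k) : (sigma p k x).coeff 0 = x.coeff 0 ^ p :=
  coeff_frobenius_charP p x 0

theorem sigma_teichmuller (x : k) : sigma p k (teichmuller p x) = teichmuller p (x ^ p) := by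
  change frobenius (teichmuller p x) = _
  rw [frobenius_eq_map_frobenius, map_teichmuller]
  rfl

theorem pow_p_injective : Function.Injective (fun x : k => x ^ p) := (frobenius_inj k p)

theorem p_ne_zero : (p : WittVector p k) ≠ 0 := p_nonzero p k

theorem frac_p_ne_zero : (p : FractionRing (WittVector p k)) ≠ 0 := FractionRing.p_nonzero p k

theorem eq_p_smul {a : Fin 4 → WittVector p k} (h : ∀ i, (a i).coeff 0 = 0) :
    ∃ b : Fin 4 → WittVector p k, a = (p : WittVector p k) • b := by
  choose b hb using fun i => (coeff_zero_eq_zero_iff (a i)).mp (h i)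
  exact ⟨b, funext hb⟩

/-! ### The submodules `Fⁿ M₃` -/

theorem mem_FPow_one {z : M3 p k} : z ∈ FPow p k 1 ↔ redFst z = 0 := by
  constructor
  · rintro ⟨y, -, rfl⟩
    ext i
    exact (coeff_zero_eq_zero_iff _).mpr ⟨_, rfl⟩
  · intro h
    obtain ⟨b, hb⟩ := eq_p_smul (fun i => congrFun h i)
    refine ⟨(fun i => (sigma p k).symm (z.2 i), fun i => (sigma p k).symm (b i)), trivial, ?_⟩
    refine Prod.ext (funext fun i => ?_) (funext fun i => ?_)
    · change (p : WittVector p k) * sigma p k ((sigma p k).symm (b i)) = _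
      rw [RingEquiv.apply_symm_apply, hb]
      rfl
    · exact (sigma p k).apply_symm_apply _

theorem Phi_surjective : Function.Surjective (Phi p k) := fun z =>
  ⟨(fun i => (sigma p k).symm ((sigma p k).symm (z.1 i)),
    fun i => (sigma p k).symm ((sigma p k).symm (z.2 i))), by
      refine Prod.ext (funext fun i => ?_) (funext fun i => ?_)
      · change sigma p k (sigma p k _) = _
        simp only [RingEquiv.apply_symm_apply]
      · change sigma p k (sigma p k _) = _
        simp only [RingEquiv.apply_symm_apply]⟩

theorem mem_FPow_two {z : M3 p k} : z ∈ FPow p k 2 ↔ ∃ y, z = (p : WittVector p k) • y := by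
  constructor
  · rintro ⟨_, ⟨y, -, rfl⟩, rfl⟩
    exact ⟨_, F_F p k y⟩
  · rintro ⟨y, rfl⟩
    obtain ⟨x, rfl⟩ := Phi_surjective y
    exact ⟨_, ⟨x, trivial, rfl⟩, F_F p k x⟩

theorem p_smul_mem_FPow_two (z : M3 p k) : (p : WittVector p k) • z ∈ FPow p k 2 :=
  mem_FPow_two.mpr ⟨z, rfl⟩

theorem F_p_smul (z : M3 p k) : F p k ((p : WittVector p k) • z) = (p : WittVector p k) • F p k z := by
  rw [LinearMap.map_smulₛₗ]
  simp

theorem FPow_succ (n : ℕ) : FPow p k (n + 1) = (FPow p k n).map (F p k) :=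
  Function.iterate_succ_apply' _ _ _

theorem mem_FPow_three {z : M3 p k} :
    z ∈ FPow p k 3 ↔ ∃ y ∈ FPow p k 1, z = (p : WittVector p k) • y := by
  rw [FPow_succ]
  constructor
  · rintro ⟨_, hx, rfl⟩
    obtain ⟨y, rfl⟩ := mem_FPow_two.mp hx
    exact ⟨F p k y, ⟨y, trivial, rfl⟩, F_p_smul y⟩
  · rintro ⟨_, ⟨y, -, rfl⟩, rfl⟩
    exact ⟨_, p_smul_mem_FPow_two y, F_p_smul y⟩

theorem FPow_anti {m n : ℕ} (h : m ≤ n) : FPow p k n ≤ FPow p k m := by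
  obtain ⟨d, rfl⟩ := Nat.exists_eq_add_of_le h
  clear h
  induction d generalizing m with
  | zero => exact le_rfl
  | succ d ih =>
    refine le_trans ?_ (ih (m := m))
    have : ∀ n, FPow p k (n + 1) ≤ FPow p k n := by
      intro n
      induction n with
      | zero => exact le_top
      | succ n ihn => rw [FPow_succ n, FPow_succ (n + 1)]; exact Submodule.map_mono ihn
    exact this _

/-! ### The pairing -/

variable (p k) in
/-- The subring `W` of `Frac W`. -/
def integers : Subring (FractionRing (WittVector p k)) :=
  (algebraMap (WittVector p k) (FractionRing (WittVector p k))).range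

theorem mem_dual {N : Lat p k} {y : M3 p k} :
    y ∈ dual p k N ↔ ∀ x ∈ N, pairing p k x y ∈ integers p k := Iff.rfl

theorem algebraMap_mem_integers (c : WittVector p k) :
    algebraMap (WittVector p k) (FractionRing (WittVector p k)) c ∈ integers p k := ⟨c, rfl⟩

theorem algebraMap_div_p_mem_iff (c : WittVector p k) :
    algebraMap (WittVector p k) (FractionRing (WittVector p k)) c / p ∈ integers p k ↔
      c.coeff 0 = 0 := by
  rw [coeff_zero_eq_zero_iff]
  constructor
  · rintro ⟨y, hy⟩
    refine ⟨y, ?_⟩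
    apply IsFractionRing.injective (WittVector p k) (FractionRing (WittVector p k))
    rw [eq_div_iff frac_p_ne_zero] at hy
    rw [map_mul, map_natCast, mul_comm, hy]
  · rintro ⟨y, rfl⟩
    refine ⟨y, ?_⟩
    rw [map_mul, map_natCast, mul_div_cancel_left₀ _ frac_p_ne_zero]

theorem pairing_comm (x y : M3 p k) : pairing p k x y = -pairing p k y x := by
  unfold pairing
  rw [alt_comm x.1, alt_comm x.2, map_neg, map_neg]
  ring

theorem pairing_self (x : M3 p k) : pairing p k x x = 0 := by
  simp [pairing, alt_self]

theorem pairing_mem_comm {x y : M3 p k} (h : pairing p k x y ∈ integers p k) :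
    pairing p k y x ∈ integers p k := by
  rw [pairing_comm]
  exact neg_mem h

theorem pairing_add_left (x y z : M3 p k) :
    pairing p k (x + y) z = pairing p k x z + pairing p k y z := by
  rw [pairing_comm, pairing_add_right, pairing_comm z, pairing_comm z]
  ring

theorem pairing_smul_left (c : WittVector p k) (x y : M3 p k) :
    pairing p k (c • x) y = algebraMap _ _ c * pairing p k x y := by
  rw [pairing_comm, pairing_smul_right, pairing_comm y]
  ring

theorem pairing_smul_mem {x y : M3 p k} (h : pairing p k x y ∈ integers p k) (c : WittVector p k) :
    pairing p k x (c • y) ∈ integers p k := by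
  rw [pairing_smul_right]
  exact mul_mem (algebraMap_mem_integers c) h

theorem pairing_smul_mem' {x y : M3 p k} (h : pairing p k x y ∈ integers p k) (c : WittVector p k) :
    pairing p k (c • x) y ∈ integers p k := by
  rw [pairing_smul_left]
  exact mul_mem (algebraMap_mem_integers c) h

theorem pairing_add_mem {x y z : M3 p k} (h : pairing p k x y ∈ integers p k)
    (h' : pairing p k x z ∈ integers p k) : pairing p k x (y + z) ∈ integers p k := by
  rw [pairing_add_right]
  exact add_mem h h'

theorem pairing_add_mem' {x y z : M3 p k} (h : pairing p k x z ∈ integers p k)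
    (h' : pairing p k y z ∈ integers p k) : pairing p k (x + y) z ∈ integers p k := by
  rw [pairing_add_left]
  exact add_mem h h'

theorem dual_anti {N N' : Lat p k} (h : N ≤ N') : dual p k N' ≤ dual p k N :=
  fun _ hy x hx => hy x (h hx)

theorem mem_dual_span_sup {N : Lat p k} {z y : M3 p k} :
    y ∈ dual p k (Submodule.span _ {z} ⊔ N) ↔
      pairing p k z y ∈ integers p k ∧ y ∈ dual p k N := by
  constructor
  · intro h
    exact ⟨h z (Submodule.mem_sup_left (Submodule.mem_span_singleton_self z)),
      dual_anti le_sup_right h⟩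
  · rintro ⟨h1, h2⟩ x hx
    obtain ⟨c, n, hn, rfl⟩ := mem_span_sup_iff.mp hx
    exact pairing_add_mem' (pairing_smul_mem' h1 c) (h2 n hn)

theorem pairing_p_smul_left (x y : M3 p k) :
    pairing p k ((p : WittVector p k) • x) y =
      algebraMap _ _ (alt x.1 y.1) / p + algebraMap _ _ (alt x.2 y.2) := by
  rw [pairing_smul_left, pairing, map_natCast]
  have := frac_p_ne_zero (p := p) (k := k)
  field_simp

theorem exists_alt_ne_zero {a : Fin 4 → k} (h : ∀ b : Fin 4 → k, alt b a = 0) : a = 0 := by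
  have h0 := h (Pi.single 0 1)
  have h1 := h (Pi.single 1 1)
  have h2 := h (Pi.single 2 1)
  have h3 := h (Pi.single 3 1)
  simp [alt] at h0 h1 h2 h3
  ext i
  fin_cases i <;> assumption

/-- As `F² M₃ = p M₃`, only the `xᵢ`-part of ⟨p x, y⟩ has a denominator, and it is p. Integrality
thus means that the first reduction of y is orthogonal to everything, and `alt` is nondegenerate. -/
theorem dual_FPow_two : dual p k (FPow p k 2) = FPow p k 1 := by
  ext y
  rw [mem_FPow_one]
  constructor
  · intro h
    refine exists_alt_ne_zero fun b => ?_
    have h1 := h _ (p_smul_mem_FPow_two (fun i => teichmuller p (b i), 0))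
    change _ ∈ integers p k at h1
    rw [pairing_p_smul_left] at h1
    have h2 := (add_mem_cancel_right (algebraMap_mem_integers _)).mp h1
    rw [algebraMap_div_p_mem_iff, coeff_zero_alt] at h2
    exact h2
  · intro h x hx
    obtain ⟨x, rfl⟩ := mem_FPow_two.mp hx
    change _ ∈ integers p k
    rw [pairing_p_smul_left]
    refine add_mem ?_ (algebraMap_mem_integers _)
    rw [algebraMap_div_p_mem_iff, coeff_zero_alt]
    change alt _ (redFst y) = 0
    rw [h, alt_zero_right]

theorem pairing_FPow_one_FPow_two {x y : M3 p k} (hx : x ∈ FPow p k 1) (hy : y ∈ FPow p k 2) :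
    pairing p k x y ∈ integers p k := by
  rw [← dual_FPow_two] at hx
  exact pairing_mem_comm (hx y hy)

theorem pairing_FPow_three {x y : M3 p k} (hy : y ∈ FPow p k 3) :
    pairing p k x y ∈ integers p k := by
  obtain ⟨y, hy', rfl⟩ := mem_FPow_three.mp hy
  rw [pairing_smul_right, ← pairing_smul_left]
  exact pairing_mem_comm (pairing_FPow_one_FPow_two hy' (p_smul_mem_FPow_two x))

theorem dual_FPow_three : dual p k (FPow p k 3) = ⊤ :=
  top_unique fun _ _ _ hx => pairing_mem_comm (pairing_FPow_three hx)

/-- Testing y against `p M₃` makes its `xᵢ`-part divisible by p, and testing against the `F xᵢ` does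
the same for the other part. After division by p, the test against the `xᵢ` puts the quotient into
`F M₃`, and `p F M₃ = F³ M₃`. -/
theorem dual_top : dual p k ⊤ = FPow p k 3 := by
  refine le_antisymm ?_ fun y hy x _ => pairing_FPow_three hy
  intro y hy
  rw [mem_FPow_three]
  have h1 : redFst y = 0 := by
    rw [← mem_FPow_one, ← dual_FPow_two]
    exact dual_anti le_top hy
  obtain ⟨a, ha⟩ := eq_p_smul (fun i => congrFun h1 i)
  have h2 : ∀ i, (y.2 i).coeff 0 = 0 := by
    intro i
    refine congrFun (exists_alt_ne_zero (a := redSnd y) fun b => ?_) i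
    have h3 := hy ((0, fun i => teichmuller p (b i)) : M3 p k) trivial
    change _ ∈ integers p k at h3
    rw [pairing] at h3
    simp only [alt_zero_left, map_zero, zero_div, zero_add] at h3
    rw [algebraMap_div_p_mem_iff, coeff_zero_alt] at h3
    exact h3
  obtain ⟨b, hb⟩ := eq_p_smul h2
  refine ⟨(a, b), ?_, Prod.ext ha hb⟩
  rw [mem_FPow_one]
  refine exists_alt_ne_zero fun c => ?_
  have h3 := hy ((fun i => teichmuller p (c i), 0) : M3 p k) trivial
  change _ ∈ integers p k at h3
  rw [pairing] at h3
  simp only [alt_zero_left, map_zero, zero_div, add_zero, ha, alt_smul_right] at h3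
  rw [map_mul, map_natCast, pow_two, mul_div_mul_left _ _ frac_p_ne_zero,
    algebraMap_div_p_mem_iff, coeff_zero_alt] at h3
  exact h3

/-- The form `p ⟨x, F y⟩` modulo `p`. -/
def hForm (x y : M3 p k) : k :=
  alt (redFst x) (fun i => redSnd y i ^ p) + alt (redSnd x) (fun i => redFst y i ^ p)

theorem pairing_F_mem_iff (x y : M3 p k) :
    pairing p k x (F p k y) ∈ integers p k ↔ hForm x y = 0 := by
  have : pairing p k x (F p k y) = algebraMap _ _ (alt x.1 (fun i => sigma p k (y.2 i)) +
      alt x.2 (fun i => sigma p k (y.1 i))) / p := by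
    have h : (F p k y).1 = (p : WittVector p k) • fun i => sigma p k (y.2 i) := rfl
    rw [pairing, h, alt_smul_right, map_mul, map_natCast, pow_two,
      mul_div_mul_left _ _ frac_p_ne_zero, map_add, add_div]
    rfl
  rw [this, algebraMap_div_p_mem_iff, add_coeff_zero, coeff_zero_alt, coeff_zero_alt, hForm]
  simp only [coeff_zero_sigma]
  rfl

/-- Applying σ turns `V` on y into `F` on x, up to the sign of the alternating form. It raises the
zeroth component to the power p, so it does not change whether that component vanishes. -/
theorem pairing_V_mem_iff (x y : M3 p k) :
    pairing p k x (V p k y) ∈ integers p k ↔ hForm y x = 0 := by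
  have : pairing p k x (V p k y) = algebraMap _ _ (alt x.1 (fun i => (sigma p k).symm (y.2 i)) +
      alt x.2 (fun i => (sigma p k).symm (y.1 i))) / p := by
    have h : (V p k y).1 = (p : WittVector p k) • fun i => (sigma p k).symm (y.2 i) := rfl
    rw [pairing, h, alt_smul_right, map_mul, map_natCast, pow_two,
      mul_div_mul_left _ _ frac_p_ne_zero, map_add, add_div]
    rfl
  have hs : ∀ a b : Fin 4 → WittVector p k, sigma p k (alt a b) =
      alt (fun i => sigma p k (a i)) (fun i => sigma p k (b i)) :=
    map_alt (sigma p k : WittVector p k →+* WittVector p k)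
  rw [this, algebraMap_div_p_mem_iff, ← pow_eq_zero_iff (Nat.Prime.ne_zero (Fact.out : p.Prime)),
    ← coeff_zero_sigma, map_add, hs, hs]
  simp only [RingEquiv.apply_symm_apply]
  rw [add_coeff_zero, coeff_zero_alt, coeff_zero_alt, hForm, ← neg_eq_zero, neg_add, ← alt_comm,
    ← alt_comm, add_comm]
  simp only [coeff_zero_sigma]
  rfl

/-- `F N` and `V N'` pair integrally with `N'`, `N` if the form `p ⟨x, F y⟩` vanishes mod `p`. -/
theorem FV_le_dual_iff {N : Lat p k} :
    FV p k N ≤ dual p k N ↔ ∀ x ∈ N, ∀ y ∈ N, hForm x y = 0 := by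
  constructor
  · intro h x hx y hy
    rw [← pairing_F_mem_iff]
    exact h (Submodule.mem_sup_left ⟨y, hy, rfl⟩) x hx
  · intro h
    refine sup_le ?_ ?_
    · rintro _ ⟨y, hy, rfl⟩ x hx
      exact (pairing_F_mem_iff x y).mpr (h x hx y hy)
    · rintro _ ⟨y, hy, rfl⟩ x hx
      exact (pairing_V_mem_iff x y).mpr (h y hy x hx)

/-! ### Lengths and duality -/

/-- If z generates N' over N, then p z lies in N, so y ↦ ⟨z, y⟩ maps the dual of N to p⁻¹W / W,
which has length one. The kernel is the dual of N'. -/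
theorem relLength_dual_le_one {N N' : Lat p k} (h : N ⋖ N') :
    relLength p k (dual p k N') (dual p k N) ≤ 1 := by
  obtain ⟨z, hz, hzN⟩ := exists_mem_notMem_of_covBy h
  have hN' := eq_span_sup_of_covBy h hz hzN
  have hp := p_smul_mem_of_covBy h hz
  have hle := dual_anti h.le
  by_cases heq : dual p k N' = dual p k N
  · rw [heq, relLength_self]
    exact zero_le_one
  obtain ⟨y, hy, hyN'⟩ := SetLike.exists_of_lt (lt_of_le_of_ne hle heq)
  have hpm : ∀ x ∈ dual p k N, ∃ c : WittVector p k,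
      pairing p k z x = algebraMap _ _ c / p := by
    intro x hx
    obtain ⟨c, hc⟩ := hx _ hp
    refine ⟨c, ?_⟩
    rw [hc, pairing_smul_left, map_natCast, mul_div_cancel_left₀ _ frac_p_ne_zero]
  have hmem : ∀ x, x ∈ dual p k N' ↔ pairing p k z x ∈ integers p k ∧ x ∈ dual p k N := by
    intro x
    rw [hN', mem_dual_span_sup]
  obtain ⟨c, hc⟩ := hpm y hy
  have hc0 : c.coeff 0 ≠ 0 := by
    intro h0
    apply hyN'
    rw [hmem, hc, algebraMap_div_p_mem_iff]
    exact ⟨h0, hy⟩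
  have hspan : dual p k N = Submodule.span _ {y} ⊔ dual p k N' := by
    refine le_antisymm ?_ (sup_le ((Submodule.span_singleton_le_iff_mem _ _).mpr hy) hle)
    intro x hx
    obtain ⟨d, hd⟩ := hpm x hx
    obtain ⟨u, hu⟩ := isUnit_of_coeff_zero_ne_zero c hc0
    refine mem_span_sup_iff.mpr ⟨d * ↑u⁻¹, x - (d * ↑u⁻¹) • y, ?_, by abel⟩
    rw [hmem]
    refine ⟨?_, Submodule.sub_mem _ hx (Submodule.smul_mem _ _ hy)⟩
    have : pairing p k z (x - (d * ↑u⁻¹ : WittVector p k) • y) = 0 := by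
      rw [sub_eq_add_neg, ← neg_smul, pairing_add_right, pairing_smul_right, hd, hc, ← hu,
        mul_div_assoc', ← map_mul]
      simp [neg_div]
    rw [this]
    exact zero_mem _
  have hpy : (p : WittVector p k) • y ∈ dual p k N' := by
    rw [hmem]
    refine ⟨?_, Submodule.smul_mem _ _ hy⟩
    rw [pairing_smul_right, hc, map_natCast, mul_div_cancel₀ _ frac_p_ne_zero]
    exact algebraMap_mem_integers c
  have := covBy_span_sup hpy hyN'
  rw [← hspan] at this
  exact ((relLength_eq_one_iff hle).mpr this).le

/-- Since p² z lies in `F³ M₃ ≤ N`, one of z and p z is outside N but carried into N by p. -/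
theorem exists_covBy {N N' : Lat p k} (hN : FPow p k 3 ≤ N) (h : N < N') :
    ∃ N'', N ⋖ N'' ∧ N'' ≤ N' := by
  obtain ⟨z, hz, hzN⟩ := SetLike.exists_of_lt h
  have key : ∀ z ∈ N', z ∉ N → (p : WittVector p k) • z ∈ N → ∃ N'', N ⋖ N'' ∧ N'' ≤ N' :=
    fun z hz hzN hp => ⟨_, covBy_span_sup hp hzN,
      sup_le ((Submodule.span_singleton_le_iff_mem _ _).mpr hz) h.le⟩
  by_cases hp : (p : WittVector p k) • z ∈ N
  · exact key z hz hzN hp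
  · refine key _ (N'.smul_mem _ hz) hp (hN (mem_FPow_three.mpr ⟨_, ?_, rfl⟩))
    exact FPow_anti (by norm_num) (p_smul_mem_FPow_two z)

theorem relLength_dual_le : ∀ (n : ℕ) {N N' : Lat p k}, FPow p k 3 ≤ N → N ≤ N' →
    relLength p k N N' = n → relLength p k (dual p k N') (dual p k N) ≤ n
  | 0, N, N', _, h, hn => by
    rw [eq_of_le_of_relLength h hn, relLength_self]
    exact zero_le
  | n + 1, N, N', hN, h, hn => by
    have hlt : N < N' := by
      refine lt_of_le_of_ne h ?_
      rintro rfl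
      rw [relLength_self] at hn
      exact absurd hn.symm (by exact_mod_cast Nat.succ_ne_zero n)
    obtain ⟨N'', h1, h2⟩ := exists_covBy hN hlt
    have h3 := relLength_add h1.le h2
    rw [hn, (relLength_eq_one_iff h1.le).mpr h1, Nat.cast_succ, add_comm] at h3
    have h4 := relLength_dual_le n (hN.trans h1.le) h2
      (ENat.add_right_injective_of_ne_top (n := 1) (by norm_num) h3).symm
    rw [relLength_add (dual_anti h2) (dual_anti h1.le), Nat.cast_succ]
    exact add_le_add h4 (relLength_dual_le_one h1)

end Perfect

/-! ### Lengths read off from coordinates. -/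

section Perfect

variable [CharP k p] [PerfectRing k p]

theorem eq_coeff_zero_of_sum_single {d : ℕ} (c : Fin d → k) (i : Fin d) :
    (∑ j, c j • (Pi.single j 1 : Fin d → k)) i = c i := by
  simp [Finset.sum_apply, Pi.single_apply]

/-- The map r plays the role of a dual basis of the eᵢ. Independence and spanning modulo N' both
reduce to linear algebra over k in this way. -/
theorem IndepMod.of_red {d : ℕ} {N' : Lat p k} {e : Fin d → M3 p k}
    (r : M3 p k →ₛₗ[(constantCoeff : WittVector p k →+* k)] (Fin d → k))
    (hN' : ∀ z ∈ N', r z = 0) (he : ∀ i, r (e i) = Pi.single i 1)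
    (hp : ∀ i, (p : WittVector p k) • e i ∈ N') : IndepMod e N' := by
  refine ⟨hp, fun c hc i => ?_⟩
  have h1 := hN' _ hc
  simp only [map_sum, LinearMap.map_smulₛₗ, he] at h1
  have h2 := congrFun h1 i
  rwa [eq_coeff_zero_of_sum_single] at h2

theorem span_sup_eq_of_red {d : ℕ} {N' N : Lat p k} {e : Fin d → M3 p k}
    (r : M3 p k →ₛₗ[(constantCoeff : WittVector p k →+* k)] (Fin d → k))
    (hN : N' ≤ N) (hN' : ∀ z ∈ N, r z = 0 → z ∈ N') (heN : ∀ i, e i ∈ N)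
    (he : ∀ i, r (e i) = Pi.single i 1) :
    Submodule.span _ (Set.range e) ⊔ N' = N := by
  refine le_antisymm (sup_le (Submodule.span_le.mpr ?_) hN) fun z hz => ?_
  · rintro _ ⟨i, rfl⟩
    exact heN i
  · have hs : ∑ i, teichmuller p (r z i) • e i ∈ Submodule.span (WittVector p k) (Set.range e) :=
      Submodule.sum_mem _ fun i _ => Submodule.smul_mem _ _ (Submodule.subset_span ⟨i, rfl⟩)
    have hsN : ∑ i, teichmuller p (r z i) • e i ∈ N :=
      Submodule.sum_mem _ fun i _ => Submodule.smul_mem _ _ (heN i)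
    refine Submodule.mem_sup.mpr ⟨_, hs, z - ∑ i, teichmuller p (r z i) • e i, ?_, by abel⟩
    refine hN' _ (N.sub_mem hz hsN) ?_
    ext i
    simp only [map_sub, map_sum, LinearMap.map_smulₛₗ, he]
    rw [Pi.sub_apply, eq_coeff_zero_of_sum_single]
    exact sub_self _

theorem relLength_of_red {d : ℕ} {N' N : Lat p k} (e : Fin d → M3 p k)
    (r : M3 p k →ₛₗ[(constantCoeff : WittVector p k →+* k)] (Fin d → k))
    (hN : N' ≤ N) (hN' : ∀ z ∈ N, z ∈ N' ↔ r z = 0) (heN : ∀ i, e i ∈ N)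
    (he : ∀ i, r (e i) = Pi.single i 1) (hp : ∀ i, (p : WittVector p k) • e i ∈ N') :
    relLength p k N' N = d := by
  have h1 := relLength_sup_span (IndepMod.of_red r (fun z hz => (hN' z (hN hz)).mp hz) he hp)
  rwa [span_sup_eq_of_red r hN (fun z hz => (hN' z hz).mpr) heN he] at h1

/-- The Teichmüller lift to the span of the `xᵢ`. -/
def liftFst (a : Fin 4 → k) : M3 p k := (fun i => teichmuller p (a i), 0)

/-- The Teichmüller lift to the span of the `F xᵢ`. -/
def liftSnd (a : Fin 4 → k) : M3 p k := (0, fun i => teichmuller p (a i))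

@[simp] theorem redFst_liftFst (a : Fin 4 → k) : redFst (liftFst (p := p) a) = a := rfl

@[simp] theorem redSnd_liftFst (a : Fin 4 → k) : redSnd (liftFst (p := p) a) = 0 :=
  funext fun _ => zero_coeff p k 0

@[simp] theorem redFst_liftSnd (a : Fin 4 → k) : redFst (liftSnd (p := p) a) = 0 :=
  funext fun _ => zero_coeff p k 0

@[simp] theorem redSnd_liftSnd (a : Fin 4 → k) : redSnd (liftSnd (p := p) a) = a := rfl

theorem mem_FPow_two_iff_red {z : M3 p k} : z ∈ FPow p k 2 ↔ redFst z = 0 ∧ redSnd z = 0 := by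
  rw [mem_FPow_two]
  constructor
  · rintro ⟨y, rfl⟩
    simp [LinearMap.map_smulₛₗ]
  · rintro ⟨h1, h2⟩
    obtain ⟨a, ha⟩ := eq_p_smul fun i => congrFun h1 i
    obtain ⟨b, hb⟩ := eq_p_smul fun i => congrFun h2 i
    exact ⟨(a, b), Prod.ext ha hb⟩

theorem p_smul_mem_FPow_one (z : M3 p k) : (p : WittVector p k) • z ∈ FPow p k 1 :=
  FPow_anti one_le_two (p_smul_mem_FPow_two z)

theorem p_smul_mem_FPow_three_iff {z : M3 p k} :
    (p : WittVector p k) • z ∈ FPow p k 3 ↔ z ∈ FPow p k 1 := by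
  rw [mem_FPow_three]
  constructor
  · rintro ⟨y, hy, h⟩
    have := smul_right_injective (M3 p k) (p_ne_zero (p := p) (k := k)) h
    exact this ▸ hy
  · exact fun h => ⟨z, h, rfl⟩

theorem indepMod_FPow_one : IndepMod (p := p) (k := k)
    (fun i : Fin 4 => liftFst (Pi.single i 1)) (FPow p k 1) :=
  IndepMod.of_red redFst (fun _ => mem_FPow_one.mp) (fun _ => rfl) fun _ => p_smul_mem_FPow_one _

theorem relLength_FPow_one : relLength p k (FPow p k 1) ⊤ = 4 :=
  relLength_of_red (fun i : Fin 4 => liftFst (Pi.single i 1)) redFst le_top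
    (fun _ _ => mem_FPow_one) (fun _ => trivial) (fun _ => rfl) fun _ => p_smul_mem_FPow_one _

theorem relLength_FPow_two : relLength p k (FPow p k 2) (FPow p k 1) = 4 :=
  relLength_of_red (fun i : Fin 4 => liftSnd (Pi.single i 1)) redSnd (FPow_anti one_le_two)
    (fun z hz => by rw [mem_FPow_two_iff_red, mem_FPow_one.mp hz]; simp)
    (fun _ => mem_FPow_one.mpr (redFst_liftSnd _)) (fun _ => rfl) fun _ => p_smul_mem_FPow_two _

/-- Multiplication by p carries the basis of `M₃ / F M₃` to one of `F² M₃ / F³ M₃`, because p z lies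
in `F³ M₃` exactly when z lies in `F M₃`. -/
theorem relLength_FPow_three : relLength p k (FPow p k 3) (FPow p k 2) = 4 := by
  have h1 : IndepMod (p := p) (k := k)
      (fun i : Fin 4 => (p : WittVector p k) • liftFst (Pi.single i 1)) (FPow p k 3) := by
    refine ⟨fun i => p_smul_mem_FPow_three_iff.mpr (p_smul_mem_FPow_one _), fun c hc => ?_⟩
    refine indepMod_FPow_one.coeff_zero c ?_
    rw [← p_smul_mem_FPow_three_iff, Finset.smul_sum]
    simpa only [smul_comm _ (p : WittVector p k)] using hc
  have h2 := relLength_sup_span h1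
  have h3 : Submodule.span (WittVector p k) (Set.range fun i : Fin 4 =>
      (p : WittVector p k) • (liftFst (Pi.single i 1) : M3 p k)) ⊔ FPow p k 3 = FPow p k 2 := by
    refine le_antisymm (sup_le (Submodule.span_le.mpr ?_) (FPow_anti (by norm_num))) ?_
    · rintro _ ⟨i, rfl⟩
      exact p_smul_mem_FPow_two _
    · intro z hz
      obtain ⟨y, rfl⟩ := mem_FPow_two.mp hz
      have hy : y ∈ Submodule.span (WittVector p k)
          (Set.range fun i : Fin 4 => (liftFst (Pi.single i 1) : M3 p k)) ⊔ FPow p k 1 := by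
        rw [span_sup_eq_of_red redFst le_top (fun _ _ => mem_FPow_one.mpr) (fun _ => trivial)
          fun _ => rfl]
        trivial
      obtain ⟨a, ha, b, hb, rfl⟩ := Submodule.mem_sup.mp hy
      rw [smul_add]
      refine Submodule.add_mem_sup ?_ (p_smul_mem_FPow_three_iff.mpr hb)
      obtain ⟨c, rfl⟩ := (Submodule.mem_span_range_iff_exists_fun _).mp ha
      rw [Finset.smul_sum]
      refine Submodule.sum_mem _ fun i _ => ?_
      rw [smul_comm]
      exact Submodule.smul_mem _ _ (Submodule.subset_span ⟨i, rfl⟩)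
  rwa [h3] at h2

theorem relLength_FPow_three_top : relLength p k (FPow p k 3) ⊤ = 12 := by
  rw [relLength_add (FPow_anti (m := 2) (by norm_num)) le_top,
    relLength_add (FPow_anti (m := 1) (by norm_num)) le_top, relLength_FPow_one,
    relLength_FPow_two, relLength_FPow_three]
  norm_num

/-- The length of the dual lattice. -/
theorem relLength_dual {N : Lat p k} (hN : FPow p k 3 ≤ N) {m n : ℕ}
    (h : relLength p k N ⊤ = n) (hmn : n + m = 12) : relLength p k (dual p k N) ⊤ = m := by
  have h1 := relLength_add hN le_top
  rw [relLength_FPow_three_top, h] at h1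
  have h2 : relLength p k (FPow p k 3) N = m := by
    have : ((m : ℕ∞) + n) = relLength p k (FPow p k 3) N + n := by
      rw [← h1, ← Nat.cast_add, add_comm, hmn]
      rfl
    exact (ENat.add_left_injective_of_ne_top (n := n) (ENat.natCast_ne_top n) this).symm
  have h3 := relLength_dual_le n hN le_top h
  have h4 := relLength_dual_le m le_rfl hN h2
  rw [dual_FPow_three] at h4
  have h5 := relLength_add (dual_anti (p := p) (k := k) (le_top : N ≤ ⊤)) le_top
  rw [dual_top, relLength_FPow_three_top] at h5
  rw [dual_top] at h3
  obtain ⟨x, hx⟩ := ENat.ne_top_iff_exists.mp (ne_top_of_le_ne_top (ENat.natCast_ne_top n) h3)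
  obtain ⟨y, hy⟩ := ENat.ne_top_iff_exists.mp (ne_top_of_le_ne_top (ENat.natCast_ne_top m) h4)
  rw [← hx] at h3 h5
  rw [← hy] at h4 h5 ⊢
  have h3' : x ≤ n := by exact_mod_cast h3
  have h4' : y ≤ m := by exact_mod_cast h4
  have h5' : 12 = x + y := by exact_mod_cast h5
  have : y = m := by omega
  rw [this]

theorem eq_of_le_of_relLength_top {N N' : Lat p k} (h : N ≤ N') {n : ℕ}
    (h1 : relLength p k N ⊤ = n) (h2 : relLength p k N' ⊤ = n) : N = N' := by
  refine eq_of_le_of_relLength h ?_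
  have h3 := relLength_add h le_top
  rw [h1, h2] at h3
  exact (ENat.add_left_injective_of_ne_top (n := n) (ENat.natCast_ne_top n) (by simpa using h3)).symm

theorem relLength_of_top {N N' : Lat p k} (h : N ≤ N') {n m d : ℕ}
    (h1 : relLength p k N ⊤ = n) (h2 : relLength p k N' ⊤ = m) (hd : n = d + m) :
    relLength p k N N' = d := by
  have h3 := relLength_add h le_top
  rw [h1, h2, hd, Nat.cast_add] at h3
  exact (ENat.add_left_injective_of_ne_top (n := m) (ENat.natCast_ne_top m) h3).symm

theorem covBy_of_relLength_top {N N' : Lat p k} (h : N ≤ N') {m : ℕ}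
    (h1 : relLength p k N ⊤ = (m + 1 : ℕ)) (h2 : relLength p k N' ⊤ = m) : N ⋖ N' :=
  (relLength_eq_one_iff h).mp (relLength_of_top (d := 1) h h1 h2 (add_comm _ _))

theorem relLength_top_of_covBy' {N N' : Lat p k} (h : N ⋖ N') {m : ℕ}
    (h1 : relLength p k N ⊤ = (m + 1 : ℕ)) : relLength p k N' ⊤ = m := by
  have h3 := relLength_add h.le le_top
  rw [h1, (relLength_eq_one_iff h.le).mpr h, Nat.cast_succ, add_comm] at h3
  exact (ENat.add_right_injective_of_ne_top (n := 1) (by norm_num) h3).symm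

end Perfect

/-! ### Rationality over the field with p² elements. -/

section Perfect

variable [CharP k p] [PerfectRing k p]

variable (p k) in
/-- The subfield of `k` with `p²` elements. -/
def Fq : Subfield k := (iterateFrobenius k p 2).eqLocusField (RingHom.id k)

theorem pow_p_pow_p (x : k) : (x ^ p) ^ p = x ^ p ^ 2 := by rw [← pow_mul, sq]

theorem Fq_pow_p_pow_p {x : k} (hx : x ∈ Fq p k) : (x ^ p) ^ p = x := by
  rw [pow_p_pow_p]; exact hx

theorem sigma_sigma_teichmuller {x : k} (hx : x ∈ Fq p k) :
    sigma p k (sigma p k (teichmuller p x)) = teichmuller p x := by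
  rw [sigma_teichmuller, sigma_teichmuller, Fq_pow_p_pow_p hx]

theorem Phi_smul (c : WittVector p k) (z : M3 p k) :
    Phi p k (c • z) = sigma p k (sigma p k c) • Phi p k z := by
  rw [LinearMap.map_smulₛₗ]
  rfl

theorem Phi_liftFst {a : Fin 4 → k} (ha : ∀ i, a i ∈ Fq p k) :
    Phi p k (liftFst a) = liftFst a := by
  refine Prod.ext (funext fun i => sigma_sigma_teichmuller (ha i)) (funext fun i => ?_)
  change sigma p k (sigma p k 0) = 0
  simp only [map_zero]

theorem Phi_liftSnd {a : Fin 4 → k} (ha : ∀ i, a i ∈ Fq p k) :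
    Phi p k (liftSnd a) = liftSnd a := by
  refine Prod.ext (funext fun i => ?_) (funext fun i => sigma_sigma_teichmuller (ha i))
  change sigma p k (sigma p k 0) = 0
  simp only [map_zero]

theorem V_Phi (z : M3 p k) : V p k (Phi p k z) = F p k z := by
  refine Prod.ext (funext fun i => ?_) (funext fun i => ?_)
  · change (p : WittVector p k) * (sigma p k).symm (sigma p k (sigma p k (z.2 i))) = _
    rw [RingEquiv.symm_apply_apply]
    rfl
  · exact (sigma p k).symm_apply_apply _

theorem F_Phi (z : M3 p k) : F p k (Phi p k z) = Phi p k (F p k z) := by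
  refine Prod.ext (funext fun i => ?_) (funext fun i => rfl)
  change (p : WittVector p k) * sigma p k (sigma p k (sigma p k (z.2 i))) =
    sigma p k (sigma p k ((p : WittVector p k) * sigma p k (z.2 i)))
  simp only [map_mul, map_natCast]

/-- On rational modules `F` and `V` differ only by `Φ`, which preserves the module. Hence `V` may be
ignored there. -/
theorem map_V_eq {N : Lat p k} (h : N.map (Phi p k) = N) : N.map (V p k) = N.map (F p k) := by
  conv_lhs => rw [← h]
  ext y
  constructor
  · rintro ⟨_, ⟨z, hz, rfl⟩, rfl⟩
    exact ⟨z, hz, (V_Phi z).symm⟩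
  · rintro ⟨z, hz, rfl⟩
    exact ⟨_, ⟨z, hz, rfl⟩, V_Phi z⟩

theorem FV_eq {N : Lat p k} (h : N.map (Phi p k) = N) : FV p k N = N.map (F p k) := by
  rw [FV, map_V_eq h, sup_idem]

theorem map_Phi_map_F {N : Lat p k} (h : N.map (Phi p k) = N) :
    (N.map (F p k)).map (Phi p k) = N.map (F p k) := by
  ext y
  constructor
  · rintro ⟨_, ⟨z, hz, rfl⟩, rfl⟩
    refine ⟨Phi p k z, ?_, F_Phi z⟩
    rw [← h]
    exact ⟨z, hz, rfl⟩
  · rintro ⟨z, hz, rfl⟩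
    rw [← h] at hz
    obtain ⟨y, hy, rfl⟩ := hz
    exact ⟨_, ⟨y, hy, rfl⟩, (F_Phi y).symm⟩

theorem map_Phi_FPow (n : ℕ) : (FPow p k n).map (Phi p k) = FPow p k n := by
  induction n with
  | zero => exact Submodule.map_top _ |>.trans (LinearMap.range_eq_top.mpr Phi_surjective)
  | succ n ih => rw [FPow_succ, map_Phi_map_F ih]

theorem map_Phi_sup_span {N : Lat p k} (h : N.map (Phi p k) = N) {z : M3 p k}
    (hz : Phi p k z = z) :
    (Submodule.span _ {z} ⊔ N).map (Phi p k) = Submodule.span _ {z} ⊔ N := by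
  rw [Submodule.map_sup, h, Submodule.map_span, Set.image_singleton, hz]

/-- The form has coefficients fixed by σ², so `Φ` transforms its values by the extension of σ² to
Frac W, which preserves W. -/
theorem sigma_frac_pairing (x y : M3 p k) : pairing p k x y ∈ integers p k ↔
    pairing p k (Phi p k x) (Phi p k y) ∈ integers p k := by
  let s : WittVector p k ≃+* WittVector p k := (sigma p k).trans (sigma p k)
  let f : FractionRing (WittVector p k) ≃+* FractionRing (WittVector p k) :=
    IsFractionRing.ringEquivOfRingEquiv s
  have hf : ∀ c, f (algebraMap _ _ c) = algebraMap _ _ (s c) :=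
    IsFractionRing.ringEquivOfRingEquiv_algebraMap s
  have hfp : f (pairing p k x y) = pairing p k (Phi p k x) (Phi p k y) := by
    have hs : ∀ a b : Fin 4 → WittVector p k, s (alt a b) =
      alt (fun i => s (a i)) (fun i => s (b i)) := map_alt (s : WittVector p k →+* WittVector p k)
    simp only [pairing, map_add, map_div₀, map_pow, map_natCast, hf, hs]
    rfl
  rw [← hfp]
  constructor
  · rintro ⟨c, hc⟩
    exact ⟨s c, by rw [← hc, hf]⟩
  · rintro ⟨c, hc⟩
    refine ⟨s.symm c, f.injective ?_⟩
    rw [hf, ← hc, RingEquiv.apply_symm_apply]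

theorem map_Phi_dual {N : Lat p k} (h : N.map (Phi p k) = N) :
    (dual p k N).map (Phi p k) = dual p k N := by
  ext y
  constructor
  · rintro ⟨y, hy, rfl⟩ x hx
    rw [← h] at hx
    obtain ⟨x, hx, rfl⟩ := hx
    exact (sigma_frac_pairing x y).mp (hy x hx)
  · intro hy
    obtain ⟨y, rfl⟩ := Phi_surjective y
    refine ⟨y, fun x hx => (sigma_frac_pairing x y).mpr (hy _ ?_), rfl⟩
    rw [← h]
    exact ⟨x, hx, rfl⟩

/-! ### Lines over `𝔽_{p²}` -/

/-- The Teichmüller lift of a linear combination of the `eᵢ`. -/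
def lineVec {d : ℕ} (e : Fin d → M3 p k) (c : Fin d → k) : M3 p k :=
  ∑ i, teichmuller p (c i) • e i

/-- The submodule generated by `N` and a lift of the vector with coordinates `c`. -/
def lineOver {d : ℕ} (e : Fin d → M3 p k) (N : Lat p k) (c : Fin d → k) : Lat p k :=
  Submodule.span _ {lineVec e c} ⊔ N

section Line

variable {d : ℕ} {e : Fin d → M3 p k} {N : Lat p k}

theorem IndepMod.sub_mem_iff (h : IndepMod e N) (c c' : Fin d → WittVector p k) :
    ∑ i, c i • e i - ∑ i, c' i • e i ∈ N ↔ ∀ i, (c i).coeff 0 = (c' i).coeff 0 := by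
  rw [← Finset.sum_sub_distrib]
  simp only [← sub_smul]
  rw [h.sum_mem_iff]
  refine forall_congr' fun i => ?_
  have := map_sub (constantCoeff : WittVector p k →+* k) (c i) (c' i)
  simp only [constantCoeff_apply] at this
  rw [this, sub_eq_zero]

theorem IndepMod.lineVec_mem_iff (h : IndepMod e N) (c : Fin d → k) :
    lineVec e c ∈ N ↔ c = 0 := by
  rw [lineVec, h.sum_mem_iff, funext_iff]
  rfl

theorem IndepMod.smul_lineVec_sub_mem (h : IndepMod e N) (a : WittVector p k) (c c' : Fin d → k) :
    a • lineVec e c - lineVec e c' ∈ N ↔ a.coeff 0 • c = c' := by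
  rw [lineVec, Finset.smul_sum]
  simp only [smul_smul]
  rw [lineVec, h.sub_mem_iff, funext_iff]
  simp only [mul_coeff_zero]
  rfl

theorem IndepMod.p_smul_lineVec (h : IndepMod e N) (c : Fin d → k) :
    (p : WittVector p k) • lineVec e c ∈ N := by
  rw [lineVec, Finset.smul_sum]
  refine N.sum_mem fun i _ => ?_
  rw [smul_comm]
  exact N.smul_mem _ (h.p_smul i)

theorem IndepMod.covBy_lineOver (h : IndepMod e N) {c : Fin d → k} (hc : c ≠ 0) :
    N ⋖ lineOver e N c :=
  covBy_span_sup (h.p_smul_lineVec c) fun h' => hc ((h.lineVec_mem_iff c).mp h')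

theorem IndepMod.lineVec_mem_lineOver (h : IndepMod e N) {c c' : Fin d → k} :
    lineVec e c' ∈ lineOver e N c ↔ ∃ μ : k, c' = μ • c := by
  rw [lineOver, mem_span_sup_iff]
  constructor
  · rintro ⟨a, n, hn, h'⟩
    refine ⟨a.coeff 0, ((h.smul_lineVec_sub_mem a c c').mp ?_).symm⟩
    rw [h', sub_add_cancel_left]
    exact N.neg_mem hn
  · rintro ⟨μ, rfl⟩
    refine ⟨teichmuller p μ, -(teichmuller p μ • lineVec e c - lineVec e (μ • c)), ?_, by abel⟩
    exact N.neg_mem ((h.smul_lineVec_sub_mem _ _ _).mpr rfl)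

theorem IndepMod.lineOver_eq_iff (h : IndepMod e N) {c c' : Fin d → k} (hc' : c' ≠ 0) :
    lineOver e N c = lineOver e N c' ↔ ∃ μ : k, c' = μ • c := by
  constructor
  · intro h'
    rw [← h.lineVec_mem_lineOver, h']
    exact Submodule.mem_sup_left (Submodule.mem_span_singleton_self _)
  · rintro ⟨μ, rfl⟩
    have hμ : μ ≠ 0 := by
      rintro rfl
      exact hc' (zero_smul _ _)
    refine le_antisymm ?_ ?_ <;> refine sup_le ?_ le_sup_right <;>
      rw [Submodule.span_singleton_le_iff_mem, h.lineVec_mem_lineOver]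
    · exact ⟨μ⁻¹, (inv_smul_smul₀ hμ c).symm⟩
    · exact ⟨μ, rfl⟩

theorem Phi_lineVec (he : ∀ i, Phi p k (e i) = e i) {c : Fin d → k} (hc : ∀ i, c i ∈ Fq p k) :
    Phi p k (lineVec e c) = lineVec e c := by
  rw [lineVec, map_sum]
  refine Finset.sum_congr rfl fun i _ => ?_
  rw [Phi_smul, he, sigma_sigma_teichmuller (hc i)]

theorem map_Phi_lineOver (he : ∀ i, Phi p k (e i) = e i) (hN : N.map (Phi p k) = N)
    {c : Fin d → k} (hc : ∀ i, c i ∈ Fq p k) :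
    (lineOver e N c).map (Phi p k) = lineOver e N c :=
  map_Phi_sup_span hN (Phi_lineVec he hc)

theorem lineOver_le (c : Fin d → k) :
    lineOver e N c ≤ Submodule.span _ (Set.range e) ⊔ N := by
  refine sup_le_sup_right ?_ _
  rw [Submodule.span_singleton_le_iff_mem]
  exact Submodule.sum_mem _ fun i _ => Submodule.smul_mem _ _ (Submodule.subset_span ⟨i, rfl⟩)

/-- A covering of `N` inside the span of the `eᵢ` that is stable under `Φ` is generated by a
vector over `𝔽_{p²}`. -/
theorem IndepMod.exists_lineOver (h : IndepMod e N) (he : ∀ i, Phi p k (e i) = e i)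
    {X : Lat p k} (hX : N ⋖ X) (hX' : X ≤ Submodule.span _ (Set.range e) ⊔ N)
    (hΦ : X.map (Phi p k) = X) :
    ∃ c : Fin d → Fq p k, c ≠ 0 ∧ X = lineOver e N fun i => c i := by
  obtain ⟨z, hz, hzN⟩ := exists_mem_notMem_of_covBy hX
  obtain ⟨y, hy, n, hn, rfl⟩ := Submodule.mem_sup.mp (hX' hz)
  obtain ⟨a, rfl⟩ := (Submodule.mem_span_range_iff_exists_fun _).mp hy
  set c : Fin d → k := fun i => (a i).coeff 0 with hcdef
  have hac : ∑ i, a i • e i - lineVec e c ∈ N := by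
    rw [lineVec, h.sub_mem_iff]
    intro i
    rfl
  have hcX : lineVec e c ∈ X := by
    have h1 : ∑ i, a i • e i ∈ X := by
      have := X.sub_mem hz (hX.le hn)
      rwa [add_sub_cancel_right] at this
    have := X.sub_mem h1 (hX.le hac)
    rwa [sub_sub_cancel] at this
  have hc : c ≠ 0 := by
    intro h0
    apply hzN
    refine N.add_mem ?_ hn
    rw [h.sum_mem_iff]
    exact fun i => congrFun h0 i
  have hXc : X = lineOver e N c :=
    eq_span_sup_of_covBy hX hcX fun h' => hc ((h.lineVec_mem_iff c).mp h')
  obtain ⟨i₀, hi₀⟩ := Function.ne_iff.mp hc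
  -- Scaling one coordinate to 1 makes the representative unique. Stability of the line under `Φ`
  -- then forces every coordinate to be fixed by the p²-power map.
  set b : Fin d → k := (c i₀)⁻¹ • c with hbdef
  have hb0 : b i₀ = 1 := inv_mul_cancel₀ hi₀
  have hb : b ≠ 0 := by
    intro h0
    rw [h0] at hb0
    exact zero_ne_one hb0
  have hXb : X = lineOver e N b := by
    rw [hXc, h.lineOver_eq_iff hb]
    exact ⟨_, rfl⟩
  have hΦb : Phi p k (lineVec e b) = lineVec e fun i => b i ^ p ^ 2 := by
    rw [lineVec, map_sum]
    refine Finset.sum_congr rfl fun i _ => ?_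
    rw [Phi_smul, he, sigma_teichmuller, sigma_teichmuller, pow_p_pow_p]
  have hbX : Phi p k (lineVec e b) ∈ lineOver e N b := by
    rw [← hXb, ← hΦ, hXb]
    exact ⟨_, Submodule.mem_sup_left (Submodule.mem_span_singleton_self _), rfl⟩
  rw [hΦb, h.lineVec_mem_lineOver] at hbX
  obtain ⟨μ, hμ⟩ := hbX
  have hμ1 : μ = 1 := by
    have := congrFun hμ i₀
    simpa [hb0] using this.symm
  rw [hμ1, one_smul] at hμ
  refine ⟨fun i => ⟨b i, congrFun hμ i⟩, ?_, hXb⟩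
  intro h0
  apply hb
  ext i
  exact congrArg Subtype.val (congrFun h0 i)

/-- The number of coverings of `N` in the span of the `eᵢ` that are stable under `Φ`. -/
theorem IndepMod.ncard_covBy [Finite (Fq p k)] (h : IndepMod e N) (he : ∀ i, Phi p k (e i) = e i)
    (hN : N.map (Phi p k) = N) :
    {X : Lat p k | N ⋖ X ∧ X ≤ Submodule.span _ (Set.range e) ⊔ N ∧ X.map (Phi p k) = X}.ncard =
      ∑ i ∈ Finset.range d, Nat.card (Fq p k) ^ i := by
  have hmem : ∀ v : Projectivization (Fq p k) (Fin d → Fq p k),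
      (lineOver e N fun i => v.rep i) ∈ {X : Lat p k | N ⋖ X ∧
        X ≤ Submodule.span _ (Set.range e) ⊔ N ∧ X.map (Phi p k) = X} := by
    intro v
    refine ⟨h.covBy_lineOver ?_, lineOver_le _, map_Phi_lineOver he hN fun i => (v.rep i).2⟩
    intro h0
    exact v.rep_nonzero (funext fun i => Subtype.ext (congrFun h0 i))
  rw [← Projectivization.card_of_finrank (Fq p k) (Fin d → Fq p k) (by simp),
    ← Nat.card_coe_set_eq]
  refine (Nat.card_congr (Equiv.ofBijective (fun v => ⟨_, hmem v⟩) ⟨?_, ?_⟩)).symm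
  · intro v w hvw
    have hne : (fun i => ((w.rep i : Fq p k) : k)) ≠ 0 := fun h0 =>
      w.rep_nonzero (funext fun i => Subtype.ext (congrFun h0 i))
    obtain ⟨μ, hμ⟩ := (h.lineOver_eq_iff hne).mp (congrArg Subtype.val hvw)
    rw [← v.mk_rep, ← w.mk_rep, Projectivization.mk_eq_mk_iff']
    obtain ⟨i, hi⟩ := Function.ne_iff.mp v.rep_nonzero
    have hμi := congrFun hμ i
    simp only [Pi.smul_apply, smul_eq_mul] at hμi
    have hvi : ((v.rep i : Fq p k) : k) ≠ 0 := fun h0 => hi (Subtype.ext h0)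
    -- The factor between the two vectors is a priori in k; as a ratio of nonzero coordinates it
    -- lies in the small field, so no two points of the projective space are identified.
    have hμ' : μ = ((w.rep i * (v.rep i)⁻¹ : Fq p k) : k) := by
      push_cast
      rw [hμi, mul_inv_cancel_right₀ hvi]
    have hμ0 : w.rep i * (v.rep i)⁻¹ ≠ 0 := by
      intro h0
      rw [h0] at hμ'
      apply hne
      rw [hμ, hμ']
      exact zero_smul _ _
    refine ⟨(w.rep i * (v.rep i)⁻¹)⁻¹, ?_⟩
    rw [inv_smul_eq_iff₀ hμ0]
    ext j
    have := congrFun hμ j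
    rw [hμ'] at this
    exact this
  · rintro ⟨X, hX, hX', hΦ⟩
    obtain ⟨c, hc, hXc⟩ := h.exists_lineOver he hX hX' hΦ
    refine ⟨Projectivization.mk _ c hc, Subtype.ext ?_⟩
    have hne : (fun i => ((c i : Fq p k) : k)) ≠ 0 := fun h0 =>
      hc (funext fun i => Subtype.ext (congrFun h0 i))
    refine Eq.trans ((h.lineOver_eq_iff hne).mpr ?_) hXc.symm
    obtain ⟨a, ha⟩ := Projectivization.exists_smul_eq_mk_rep (Fq p k) c hc
    refine ⟨((a⁻¹ : (Fq p k)ˣ) : Fq p k), ?_⟩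
    rw [← ha]
    ext i
    simp [Units.smul_def]

end Line

end Perfect

/-! ### Cardinalities of the finite subfields. -/

section Card

open Polynomial

variable [CharP k p] [IsAlgClosed k]

/-- The polynomial X^(p^n) - X is separable and splits. The case n = 2 gives the field of
rationality, and n = 1 the solutions of the isotropy equation for `M₁`. -/
theorem ncard_pow_eq (n : ℕ) (hn : n ≠ 0) : {x : k | x ^ p ^ n = x}.ncard = p ^ n := by
  have hp : 1 < p ^ n := Nat.one_lt_pow hn (Fact.out : p.Prime).one_lt
  have hne : (X ^ p ^ n - X : k[X]) ≠ 0 := FiniteField.X_pow_card_sub_X_ne_zero k hp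
  have h1 : {x : k | x ^ p ^ n = x} = (X ^ p ^ n - X : k[X]).rootSet k := by
    ext x
    simp [mem_rootSet, hne, sub_eq_zero]
  rw [h1, ← Nat.card_coe_set_eq, Nat.card_eq_fintype_card,
    card_rootSet_eq_natDegree (galois_poly_separable p _ (dvd_pow_self p hn))
      (IsAlgClosed.splits _),
    FiniteField.X_pow_card_sub_X_natDegree_eq k hp]

theorem card_Fq : Nat.card (Fq p k) = p ^ 2 :=
  (Nat.card_coe_set_eq {x : k | x ^ p ^ 2 = x}).trans (ncard_pow_eq 2 two_ne_zero)

instance finite_Fq : Finite (Fq p k) := by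
  apply Nat.finite_of_card_ne_zero
  rw [card_Fq]
  exact pow_ne_zero _ (Fact.out : p.Prime).ne_zero

end Card

/-- The radical of `N / F N` in `F M₃ / F N` for the form `⟨x, F y⟩`, as a submodule. -/
def rad [CharP k p] [PerfectRing k p] (N : Lat p k) : Lat p k :=
  FPow p k 1 ⊓ (dual p k N).comap (F p k)

/-! ### Frames: coordinates adapted to a rational `M₂`. -/

section Perfect

variable [CharP k p] [PerfectRing k p]

/-- Expansion with respect to a symplectic basis that contains a given vector. -/
theorem exists_symplectic_basis (K : Subfield k) {s : Fin 4 → k} (hs : ∀ i, s i ∈ K)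
    (hs0 : s ≠ 0) : ∃ f₁ f₂ f₃ : Fin 4 → k,
      (∀ i, f₁ i ∈ K) ∧ (∀ i, f₂ i ∈ K) ∧ (∀ i, f₃ i ∈ K) ∧
      alt s f₁ = 0 ∧ alt s f₂ = 0 ∧ alt s f₃ = 1 ∧ alt f₁ f₂ = 1 ∧ alt f₁ f₃ = 0 ∧
      alt f₂ f₃ = 0 ∧ ∀ b, b = alt b f₃ • s + alt s b • f₃ + alt b f₂ • f₁ + alt f₁ b • f₂ := by
  have hd : ∀ {x y : k}, x ∈ K → y ∈ K → x / y ∈ K := fun hx hy => K.div_mem hx hy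
  have hn : ∀ {x : k}, x ∈ K → -x ∈ K := fun hx => K.neg_mem hx
  have h01 := K.zero_mem
  have h11 := K.one_mem
  obtain ⟨i, hi⟩ := Function.ne_iff.mp hs0
  have h0 := hs 0
  have h1 := hs 1
  have h2 := hs 2
  have h3 := hs 3
  -- For each coordinate of s that may be nonzero, a symplectic basis is written down with that
  -- coordinate as the only denominator.
  fin_cases i
  · have hi : s 0 ≠ 0 := hi
    refine ⟨![0, 1, 0, s 2 / s 0], ![0, 0, 1, -s 1 / s 0], ![0, 0, 0, 1 / s 0], ?_, ?_, ?_, ?_, ?_,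
      ?_, ?_, ?_, ?_, ?_⟩
    · intro i; fin_cases i <;> simp [*]
    · intro i; fin_cases i <;> simp [*]
    · intro i; fin_cases i <;> simp [*]
    iterate 6
      focus first | (simp [alt]; done) | (simp [alt]; field_simp; done) | (simp [alt]; field_simp; ring1)
    intro b
    refine funext fun i => ?_
    simp only [Pi.add_apply, Pi.smul_apply, smul_eq_mul]
    fin_cases i <;>
      focus first | (simp [alt]; done) | (simp [alt]; field_simp; done) | (simp [alt]; field_simp; ring1)
  · have hi : s 1 ≠ 0 := hi
    refine ⟨![1, 0, s 3 / s 1, 0], ![0, 0, -s 0 / s 1, 1], ![0, 0, 1 / s 1, 0], ?_, ?_, ?_, ?_, ?_,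
      ?_, ?_, ?_, ?_, ?_⟩
    · intro i; fin_cases i <;> simp [*]
    · intro i; fin_cases i <;> simp [*]
    · intro i; fin_cases i <;> simp [*]
    iterate 6
      focus first | (simp [alt]; done) | (simp [alt]; field_simp; done) | (simp [alt]; field_simp; ring1)
    intro b
    refine funext fun i => ?_
    simp only [Pi.add_apply, Pi.smul_apply, smul_eq_mul]
    fin_cases i <;>
      focus first | (simp [alt]; done) | (simp [alt]; field_simp; done) | (simp [alt]; field_simp; ring1)
  · have hi : s 2 ≠ 0 := hi
    refine ⟨![1, -s 3 / s 2, 0, 0], ![0, s 0 / s 2, 0, 1], ![0, -1 / s 2, 0, 0], ?_, ?_, ?_, ?_, ?_,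
      ?_, ?_, ?_, ?_, ?_⟩
    · intro i; fin_cases i <;> simp [*]
    · intro i; fin_cases i <;> simp [*]
    · intro i; fin_cases i <;> simp [*]
    iterate 6
      focus first | (simp [alt]; done) | (simp [alt]; field_simp; done) | (simp [alt]; field_simp; ring1)
    intro b
    refine funext fun i => ?_
    simp only [Pi.add_apply, Pi.smul_apply, smul_eq_mul]
    fin_cases i <;>
      focus first | (simp [alt]; done) | (simp [alt]; field_simp; done) | (simp [alt]; field_simp; ring1)
  · have hi : s 3 ≠ 0 := hi
    refine ⟨![-s 2 / s 3, 1, 0, 0], ![s 1 / s 3, 0, 1, 0], ![-1 / s 3, 0, 0, 0], ?_, ?_, ?_, ?_, ?_,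
      ?_, ?_, ?_, ?_, ?_⟩
    · intro i; fin_cases i <;> simp [*]
    · intro i; fin_cases i <;> simp [*]
    · intro i; fin_cases i <;> simp [*]
    iterate 6
      focus first | (simp [alt]; done) | (simp [alt]; field_simp; done) | (simp [alt]; field_simp; ring1)
    intro b
    refine funext fun i => ?_
    simp only [Pi.add_apply, Pi.smul_apply, smul_eq_mul]
    fin_cases i <;>
      focus first | (simp [alt]; done) | (simp [alt]; field_simp; done) | (simp [alt]; field_simp; ring1)

theorem alt_neg_right (a b : Fin 4 → k) : alt a (-b) = -alt a b := by
  rw [← neg_one_smul k b, alt_smul_right, neg_one_mul]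

variable (p k) in
/-- A vector over `𝔽_{p²}` with a symplectic basis that contains its Frobenius twist. -/
structure Frame where
  a : Fin 4 → k
  f₁ : Fin 4 → k
  f₂ : Fin 4 → k
  f₃ : Fin 4 → k
  a_mem (i : Fin 4) : a i ∈ Fq p k
  f₁_mem (i : Fin 4) : f₁ i ∈ Fq p k
  f₂_mem (i : Fin 4) : f₂ i ∈ Fq p k
  f₃_mem (i : Fin 4) : f₃ i ∈ Fq p k
  alt_f₁ : alt (fun i => a i ^ p) f₁ = 0
  alt_f₂ : alt (fun i => a i ^ p) f₂ = 0
  alt_f₃ : alt (fun i => a i ^ p) f₃ = 1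
  alt_f₁_f₂ : alt f₁ f₂ = 1
  alt_f₁_f₃ : alt f₁ f₃ = 0
  alt_f₂_f₃ : alt f₂ f₃ = 0
  expand (b : Fin 4 → k) : b = alt b f₃ • (fun i => a i ^ p) + alt (fun i => a i ^ p) b • f₃ +
    alt b f₂ • f₁ + alt f₁ b • f₂

theorem alt_pow (a b : Fin 4 → k) :
    alt (fun i => a i ^ p) (fun i => b i ^ p) = alt a b ^ p := by
  have := map_alt (frobenius k p) a b
  simpa [frobenius_def] using this.symm

namespace Frame

variable (fr : Frame p k)

/-- The Frobenius twist of the vector of the frame. -/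
def s : Fin 4 → k := fun i => fr.a i ^ p

/-- The Frobenius twist of the vector dual to that of the frame. -/
def g : Fin 4 → k := fun i => fr.f₃ i ^ p

theorem s_pow (i : Fin 4) : fr.s i ^ p = fr.a i := Fq_pow_p_pow_p (fr.a_mem i)

theorem g_mem (i : Fin 4) : fr.g i ∈ Fq p k := (Fq p k).pow_mem (fr.f₃_mem i) p

/-- As a has coordinates in the field with p² elements, it is the Frobenius twist of its own twist
s. This is how conditions on a become orthogonality to s. -/
theorem alt_a_pow (b : Fin 4 → k) : alt fr.a (fun i => b i ^ p) = alt fr.s b ^ p := by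
  rw [← alt_pow]
  simp only [s_pow]

theorem alt_a_g : alt fr.a fr.g = 1 := by
  change alt fr.a (fun i => fr.f₃ i ^ p) = 1
  have h : alt fr.s fr.f₃ = 1 := fr.alt_f₃
  rw [alt_a_pow, h, one_pow]

theorem alt_s_f₁ : alt fr.s fr.f₁ = 0 := fr.alt_f₁
theorem alt_s_f₂ : alt fr.s fr.f₂ = 0 := fr.alt_f₂
theorem alt_s_f₃ : alt fr.s fr.f₃ = 1 := fr.alt_f₃
theorem expand' (b : Fin 4 → k) : b = alt b fr.f₃ • fr.s + alt fr.s b • fr.f₃ +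
    alt b fr.f₂ • fr.f₁ + alt fr.f₁ b • fr.f₂ := fr.expand b

theorem a_ne_zero : fr.a ≠ 0 := by
  intro h
  have := fr.alt_a_g
  rw [h, alt_zero_left] at this
  exact zero_ne_one this

/-- The submodule `M₂` of a flag given by the vector of the frame. -/
def M2 : Lat p k := Submodule.span _ {liftFst fr.a} ⊔ FPow p k 1

theorem mem_M2 {z : M3 p k} : z ∈ fr.M2 ↔ redFst z = alt (redFst z) fr.g • fr.a := by
  rw [M2, mem_span_sup_iff]
  constructor
  · rintro ⟨c, n, hn, rfl⟩
    rw [map_add, mem_FPow_one.mp hn, LinearMap.map_smulₛₗ, redFst_liftFst, add_zero, alt_smul_left,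
      fr.alt_a_g, mul_one]
  · intro h
    refine ⟨teichmuller p (alt (redFst z) fr.g), z - teichmuller p (alt (redFst z) fr.g) •
      liftFst fr.a, ?_, by abel⟩
    rw [mem_FPow_one, map_sub, LinearMap.map_smulₛₗ, redFst_liftFst, sub_eq_zero]
    exact h

theorem mem_M2_of_eq_smul {z : M3 p k} {μ : k} (h : redFst z = μ • fr.a) : z ∈ fr.M2 := by
  rw [mem_M2, h, alt_smul_left, fr.alt_a_g, mul_one]

theorem FPow_le_M2 : FPow p k 1 ≤ fr.M2 := le_sup_right

theorem map_Phi_M2 : fr.M2.map (Phi p k) = fr.M2 :=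
  map_Phi_sup_span (map_Phi_FPow 1) (Phi_liftFst fr.a_mem)

theorem FPow_covBy_M2 : FPow p k 1 ⋖ fr.M2 :=
  covBy_span_sup (p_smul_mem_FPow_one _) fun h => fr.a_ne_zero (mem_FPow_one.mp h)

theorem mem_map_F_M2 {z : M3 p k} :
    z ∈ fr.M2.map (F p k) ↔ redFst z = 0 ∧ ∃ μ : k, redSnd z = μ • fr.s := by
  constructor
  · rintro ⟨y, hy, rfl⟩
    refine ⟨mem_FPow_one.mp ⟨y, trivial, rfl⟩, alt (redFst y) fr.g ^ p, funext fun i => ?_⟩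
    have h1 : redSnd (F p k y) i = redFst y i ^ p := coeff_zero_sigma (y.1 i)
    rw [h1, fr.mem_M2.mp hy, alt_smul_left, fr.alt_a_g, mul_one]
    exact mul_pow _ _ _
  · rintro ⟨h0, μ, hμ⟩
    obtain ⟨y, -, rfl⟩ := mem_FPow_one.mpr h0
    obtain ⟨ν, rfl⟩ := (frobeniusEquiv k p).surjective μ
    refine ⟨y, fr.mem_M2_of_eq_smul (μ := ν) (funext fun i => pow_p_injective (p := p) ?_), rfl⟩
    have h1 : redSnd (F p k y) i = redFst y i ^ p := coeff_zero_sigma (y.1 i)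
    change redFst y i ^ p = (ν * fr.a i) ^ p
    rw [← h1, hμ, mul_pow]
    rfl

/-- On `M₂` the form `p ⟨x, F y⟩` is hyperbolic in two coordinates. -/
theorem hForm_eq {x y : M3 p k} (hx : x ∈ fr.M2) (hy : y ∈ fr.M2) :
    hForm x y = alt (redFst x) fr.g * alt fr.s (redSnd y) ^ p -
      alt (redFst y) fr.g ^ p * alt fr.s (redSnd x) := by
  have h1 : (fun i => redFst y i ^ p) = alt (redFst y) fr.g ^ p • fr.s := by
    funext i
    conv_lhs => rw [fr.mem_M2.mp hy]
    exact mul_pow _ _ _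
  rw [hForm, h1]
  conv_lhs => rw [fr.mem_M2.mp hx]
  rw [alt_smul_left, alt_smul_right, fr.alt_a_pow, alt_comm (redSnd x)]
  ring

/-- For z in `F M₃` the form `hForm x z` is the multiple by the a-coordinate of x of a p-th power,
so the lift of a is the only test vector needed. The reduction of `F M₂` is the line of s, and the
radical becomes s^⊥. -/
theorem mem_rad {z : M3 p k} :
    z ∈ rad fr.M2 ↔ redFst z = 0 ∧ alt fr.s (redSnd z) = 0 := by
  rw [rad, Submodule.mem_inf, mem_FPow_one]
  refine and_congr_right fun h0 => ?_
  have hz : z ∈ fr.M2 := fr.FPow_le_M2 (mem_FPow_one.mpr h0)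
  rw [Submodule.mem_comap, mem_dual]
  simp only [pairing_F_mem_iff]
  constructor
  · intro h
    have h1 := h (liftFst fr.a) (fr.mem_M2_of_eq_smul (μ := 1) (by simp))
    rw [fr.hForm_eq (fr.mem_M2_of_eq_smul (μ := 1) (by simp)) hz, h0, redFst_liftFst, fr.alt_a_g,
      redSnd_liftFst, alt_zero_right, mul_zero, sub_zero, one_mul] at h1
    exact (pow_eq_zero_iff (Fact.out : p.Prime).ne_zero).mp h1
  · intro h x hx
    rw [fr.hForm_eq hx hz, h, h0, alt_zero_left, zero_pow (Fact.out : p.Prime).ne_zero]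
    ring

theorem map_F_M2_le_rad : fr.M2.map (F p k) ≤ rad fr.M2 := by
  intro z hz
  obtain ⟨h1, μ, h2⟩ := fr.mem_map_F_M2.mp hz
  rw [mem_rad, h2, alt_smul_right, alt_self, mul_zero]
  exact ⟨h1, rfl⟩

theorem rad_le_M2 : rad fr.M2 ≤ fr.M2 := inf_le_left.trans fr.FPow_le_M2

theorem p_smul_mem_map_F_M2 (z : M3 p k) : (p : WittVector p k) • z ∈ fr.M2.map (F p k) := by
  have := mem_FPow_two_iff_red.mp (p_smul_mem_FPow_two z)
  exact fr.mem_map_F_M2.mpr ⟨this.1, 0, by rw [this.2, zero_smul]⟩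

/-- The polarization condition on `M₂` is automatic for rational modules: s is orthogonal to itself,
so `F M₂` lies in the radical. -/
theorem FV_FV_M2_le : FV p k (FV p k fr.M2) ≤ dual p k fr.M2 := by
  rw [FV_eq fr.map_Phi_M2, FV_eq (map_Phi_map_F fr.map_Phi_M2)]
  rintro _ ⟨y, hy, rfl⟩ x hx
  have h1 := fr.map_F_M2_le_rad hy
  exact h1.2 x hx

/-- Combine semilinear functionals. -/
def piRed {d : ℕ} (r : Fin d → M3 p k →ₛₗ[(constantCoeff : WittVector p k →+* k)] k) :
    M3 p k →ₛₗ[(constantCoeff : WittVector p k →+* k)] (Fin d → k) where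
  toFun z i := r i z
  map_add' x y := funext fun i => map_add (r i) x y
  map_smul' c x := funext fun i => LinearMap.map_smulₛₗ (r i) c x

/-- Pairing of the reduction with a fixed vector. -/
def altSnd (b : Fin 4 → k) : M3 p k →ₛₗ[(constantCoeff : WittVector p k →+* k)] k where
  toFun z := alt b (redSnd z)
  map_add' x y := by rw [map_add, alt_add_right]
  map_smul' c x := by rw [LinearMap.map_smulₛₗ, alt_smul_right]; rfl

/-- Pairing of the reduction with a fixed vector. -/
def altFst (b : Fin 4 → k) : M3 p k →ₛₗ[(constantCoeff : WittVector p k →+* k)] k where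
  toFun z := alt (redFst z) b
  map_add' x y := by rw [map_add, alt_add_left]
  map_smul' c x := by rw [LinearMap.map_smulₛₗ, alt_smul_left]; rfl

theorem alt_f₂_f₁ : alt fr.f₂ fr.f₁ = -1 := by rw [alt_comm, fr.alt_f₁_f₂]

theorem relLength_M2 : relLength p k (fr.M2.map (F p k)) fr.M2 = 4 := by
  -- The coordinates are pairings with g, s, f₁, f₂; the minus sign compensates `alt f₂ f₁ = -1`.
  refine relLength_of_red ![liftFst fr.a, liftSnd fr.f₃, liftSnd fr.f₂, -liftSnd fr.f₁]
    (piRed ![altFst fr.g, altSnd fr.s, altSnd fr.f₁, altSnd fr.f₂])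
    (fr.map_F_M2_le_rad.trans fr.rad_le_M2) ?_ ?_ ?_ ?_
  · intro z hz
    rw [mem_map_F_M2]
    constructor
    · rintro ⟨h1, μ, h2⟩
      ext i
      fin_cases i
      · change alt (redFst z) _ = 0
        rw [h1, alt_zero_left]
      · change alt _ (redSnd z) = 0
        rw [h2, alt_smul_right, alt_self, mul_zero]
      · change alt _ (redSnd z) = 0
        rw [h2, alt_smul_right, alt_comm, fr.alt_s_f₁, neg_zero, mul_zero]
      · change alt _ (redSnd z) = 0
        rw [h2, alt_smul_right, alt_comm, fr.alt_s_f₂, neg_zero, mul_zero]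
    · intro h
      have h0 : alt (redFst z) fr.g = 0 := congrFun h 0
      have h1 : alt fr.s (redSnd z) = 0 := congrFun h 1
      have h2 : alt fr.f₁ (redSnd z) = 0 := congrFun h 2
      have h3 : alt fr.f₂ (redSnd z) = 0 := congrFun h 3
      refine ⟨by rw [fr.mem_M2.mp hz, h0, zero_smul], alt (redSnd z) fr.f₃, ?_⟩
      conv_lhs => rw [fr.expand' (redSnd z)]
      rw [h1, h2, alt_comm _ fr.f₂, h3]
      simp
  · intro i
    fin_cases i
    · exact fr.mem_M2_of_eq_smul (μ := 1) (by simp)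
    · exact fr.FPow_le_M2 (mem_FPow_one.mpr (redFst_liftSnd _))
    · exact fr.FPow_le_M2 (mem_FPow_one.mpr (redFst_liftSnd _))
    · exact fr.FPow_le_M2 (Submodule.neg_mem _ (mem_FPow_one.mpr (redFst_liftSnd _)))
  · intro i
    ext j
    fin_cases i <;> fin_cases j <;>
      simp [piRed, altFst, altSnd, alt_zero_left, alt_zero_right, fr.alt_a_g, fr.alt_s_f₁, fr.alt_s_f₂,
        fr.alt_s_f₃, fr.alt_f₁_f₂, fr.alt_f₁_f₃, fr.alt_f₂_f₃, alt_self, fr.alt_f₂_f₁, alt_neg_right]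
  · exact fun i => fr.p_smul_mem_map_F_M2 _

end Frame

end Perfect

/-! ### Rational choices of `M₂` and `L`. -/

section Perfect

variable [CharP k p] [PerfectRing k p]

theorem alt_neg_left (a b : Fin 4 → k) : alt (-a) b = -alt a b := by
  rw [← neg_one_smul k a, alt_smul_left, neg_one_mul]

/-- A rational line has a generator a over the small field. The symplectic basis is built around the
twist of a, since this spans the reduction of `F N`. -/
theorem exists_frame {N : Lat p k} (h : FPow p k 1 ⋖ N) (hΦ : N.map (Phi p k) = N) :
    ∃ fr : Frame p k, N = fr.M2 := by
  have htop : Submodule.span (WittVector p k)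
      (Set.range fun i : Fin 4 => (liftFst (Pi.single i 1) : M3 p k)) ⊔ FPow p k 1 = ⊤ :=
    span_sup_eq_of_red redFst le_top (fun _ _ => mem_FPow_one.mpr) (fun _ => trivial) fun _ => rfl
  obtain ⟨c, hc, hN⟩ := indepMod_FPow_one.exists_lineOver (fun i => Phi_liftFst fun j => by
    by_cases hij : j = i
    · subst hij
      rw [Pi.single_eq_same]
      exact one_mem _
    · rw [Pi.single_eq_of_ne hij]
      exact zero_mem _) h (htop ▸ le_top) hΦ
  set a : Fin 4 → k := fun i => c i with ha
  have ha0 : a ≠ 0 := fun h0 => hc (funext fun i => Subtype.ext (congrFun h0 i))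
  have hs0 : (fun i => a i ^ p) ≠ 0 := fun h0 => ha0 (funext fun i =>
    (pow_eq_zero_iff (Fact.out : p.Prime).ne_zero).mp (congrFun h0 i))
  obtain ⟨f₁, f₂, f₃, h1, h2, h3, h4, h5, h6, h7, h8, h9, h10⟩ := exists_symplectic_basis (Fq p k)
    (s := fun i => a i ^ p) (fun i => (Fq p k).pow_mem (c i).2 p) hs0
  refine ⟨⟨a, f₁, f₂, f₃, fun i => (c i).2, h1, h2, h3, h4, h5, h6, h7, h8, h9, h10⟩, ?_⟩
  have hred : redFst (lineVec (fun i : Fin 4 => (liftFst (Pi.single i 1) : M3 p k)) a) = a := by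
    ext i
    simp only [lineVec, map_sum, LinearMap.map_smulₛₗ, redFst_liftFst]
    exact eq_coeff_zero_of_sum_single a i
  refine (eq_span_sup_of_covBy h ?_ ?_).trans rfl
  · rw [hN, lineOver, mem_span_sup_iff]
    refine ⟨1, liftFst a - lineVec (fun i : Fin 4 => liftFst (Pi.single i 1)) a, ?_, ?_⟩
    · rw [mem_FPow_one, map_sub, hred, redFst_liftFst, sub_self]
    · rw [one_smul]
      abel
  · exact fun h0 => ha0 (mem_FPow_one.mp h0)

theorem ncard_M2 [Finite (Fq p k)] :
    {N : Lat p k | FPow p k 1 ⋖ N ∧ N.map (Phi p k) = N}.ncard =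
      ∑ i ∈ Finset.range 4, Nat.card (Fq p k) ^ i := by
  have htop : Submodule.span (WittVector p k)
      (Set.range fun i : Fin 4 => (liftFst (Pi.single i 1) : M3 p k)) ⊔ FPow p k 1 = ⊤ :=
    span_sup_eq_of_red redFst le_top (fun _ _ => mem_FPow_one.mpr) (fun _ => trivial) fun _ => rfl
  have := (indepMod_FPow_one (p := p) (k := k)).ncard_covBy (fun i => Phi_liftFst fun j => by
    by_cases hij : j = i
    · subst hij
      rw [Pi.single_eq_same]
      exact one_mem _
    · rw [Pi.single_eq_of_ne hij]
      exact zero_mem _) (map_Phi_FPow 1)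
  rw [htop] at this
  simpa using this

namespace Frame

variable (fr : Frame p k)

/-- Lifts of a basis of the radical modulo `F M₂`. -/
def radBasis : Fin 2 → M3 p k := ![liftSnd fr.f₁, liftSnd fr.f₂]

theorem Phi_radBasis (i : Fin 2) : Phi p k (fr.radBasis i) = fr.radBasis i := by
  fin_cases i
  · exact Phi_liftSnd fr.f₁_mem
  · exact Phi_liftSnd fr.f₂_mem

theorem alt_f₁_s : alt fr.f₁ fr.s = 0 := by rw [alt_comm, fr.alt_s_f₁, neg_zero]

theorem alt_f₂_s : alt fr.f₂ fr.s = 0 := by rw [alt_comm, fr.alt_s_f₂, neg_zero]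

theorem piRed_radBasis (i : Fin 2) :
    piRed ![altSnd (-fr.f₂), altSnd fr.f₁] (fr.radBasis i) = Pi.single i 1 := by
  ext j
  fin_cases i <;> fin_cases j <;>
    simp [radBasis, piRed, altSnd, alt_neg_left, fr.alt_f₁_f₂, fr.alt_f₂_f₁, alt_self]

theorem indepMod_radBasis : IndepMod fr.radBasis (fr.M2.map (F p k)) := by
  refine IndepMod.of_red (piRed ![altSnd (-fr.f₂), altSnd fr.f₁]) ?_ fr.piRed_radBasis
    fun i => fr.p_smul_mem_map_F_M2 _
  intro z hz
  obtain ⟨-, μ, h⟩ := fr.mem_map_F_M2.mp hz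
  ext j
  fin_cases j <;> simp [piRed, altSnd, h, alt_smul_right, alt_neg_left, fr.alt_f₁_s, fr.alt_f₂_s]

theorem span_radBasis : Submodule.span _ (Set.range fr.radBasis) ⊔ fr.M2.map (F p k) =
    rad fr.M2 := by
  refine span_sup_eq_of_red (piRed ![altSnd (-fr.f₂), altSnd fr.f₁]) fr.map_F_M2_le_rad ?_ ?_
    fr.piRed_radBasis
  · intro z hz h
    obtain ⟨h1, h2⟩ := fr.mem_rad.mp hz
    have h3 : alt (-fr.f₂) (redSnd z) = 0 := congrFun h 0
    have h4 : alt fr.f₁ (redSnd z) = 0 := congrFun h 1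
    refine fr.mem_map_F_M2.mpr ⟨h1, alt (redSnd z) fr.f₃, ?_⟩
    conv_lhs => rw [fr.expand' (redSnd z)]
    rw [alt_neg_left, ← alt_comm] at h3
    simp [h2, h3, h4]
  · intro i
    rw [mem_rad]
    fin_cases i <;> simp [radBasis, fr.alt_s_f₁, fr.alt_s_f₂]

theorem ncard_L [Finite (Fq p k)] :
    {L : Lat p k | fr.M2.map (F p k) ⋖ L ∧ L ≤ rad fr.M2 ∧ L.map (Phi p k) = L}.ncard =
      ∑ i ∈ Finset.range 2, Nat.card (Fq p k) ^ i := by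
  have := fr.indepMod_radBasis.ncard_covBy fr.Phi_radBasis (map_Phi_map_F fr.map_Phi_M2)
  rwa [span_radBasis] at this

/-- The module `L` spanned by the first vector of the radical. -/
def L : Lat p k := Submodule.span _ {liftSnd fr.f₁} ⊔ fr.M2.map (F p k)

/-- Every `L` arises from a frame. -/
theorem exists_L {X : Lat p k} (h : fr.M2.map (F p k) ⋖ X) (h' : X ≤ rad fr.M2)
    (hΦ : X.map (Phi p k) = X) : ∃ fr' : Frame p k, fr'.M2 = fr.M2 ∧ X = fr'.L := by
  obtain ⟨c, hc, hX⟩ := fr.indepMod_radBasis.exists_lineOver fr.Phi_radBasis h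
    (by rwa [fr.span_radBasis]) hΦ
  -- The new first vector c₀ f₁ + c₁ f₂ is completed to a symplectic basis of the plane of f₁, f₂ by
  -- f₂ / c₀, or by -f₁ / c₁ if c₀ = 0. The last clause says that both bases give the same
  -- expansion.
  obtain ⟨g₂, hg₂, e1, e2, e3, e4⟩ : ∃ g₂ : Fin 4 → k, (∀ i, g₂ i ∈ Fq p k) ∧
      alt fr.s g₂ = 0 ∧ alt ((c 0 : k) • fr.f₁ + (c 1 : k) • fr.f₂) g₂ = 1 ∧ alt g₂ fr.f₃ = 0 ∧
      ∀ b, alt b g₂ • ((c 0 : k) • fr.f₁ + (c 1 : k) • fr.f₂) +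
        alt ((c 0 : k) • fr.f₁ + (c 1 : k) • fr.f₂) b • g₂ =
        alt b fr.f₂ • fr.f₁ + alt fr.f₁ b • fr.f₂ := by
    by_cases h0 : c 0 = 0
    · have h1 : (c 1 : k) ≠ 0 := by
        intro h1
        apply hc
        ext i
        fin_cases i
        · exact congrArg Subtype.val h0
        · exact h1
      refine ⟨(-(c 1 : k)⁻¹) • fr.f₁, fun i => (Fq p k).mul_mem
        ((Fq p k).neg_mem ((Fq p k).inv_mem (c 1).2)) (fr.f₁_mem i), ?_, ?_, ?_, ?_⟩
      · rw [alt_smul_right, fr.alt_s_f₁, mul_zero]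
      · rw [h0, alt_smul_right, alt_add_left, alt_smul_left, alt_smul_left, fr.alt_f₂_f₁, alt_self]
        field_simp
        ring
      · rw [alt_smul_left, fr.alt_f₁_f₃, mul_zero]
      · intro b
        rw [h0, alt_smul_right, alt_add_left, alt_smul_left, alt_smul_left, alt_comm fr.f₁ b,
          alt_comm fr.f₂ b]
        ext i
        simp
        field_simp
        ring
    · have h1 : (c 0 : k) ≠ 0 := fun h1 => h0 (Subtype.ext h1)
      refine ⟨((c 0 : k)⁻¹) • fr.f₂, fun i => (Fq p k).mul_mem
        ((Fq p k).inv_mem (c 0).2) (fr.f₂_mem i), ?_, ?_, ?_, ?_⟩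
      · rw [alt_smul_right, fr.alt_s_f₂, mul_zero]
      · rw [alt_smul_right, alt_add_left, alt_smul_left, alt_smul_left, fr.alt_f₁_f₂, alt_self]
        field_simp
        ring
      · rw [alt_smul_left, fr.alt_f₂_f₃, mul_zero]
      · intro b
        rw [alt_smul_right, alt_add_left, alt_smul_left, alt_smul_left, alt_comm fr.f₁ b,
          alt_comm fr.f₂ b]
        ext i
        simp
        field_simp
        ring
  have hf : alt fr.s ((c 0 : k) • fr.f₁ + (c 1 : k) • fr.f₂) = 0 := by
    rw [alt_add_right, alt_smul_right, alt_smul_right, fr.alt_s_f₁, fr.alt_s_f₂]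
    ring
  let fr' : Frame p k :=
    { a := fr.a
      f₁ := (c 0 : k) • fr.f₁ + (c 1 : k) • fr.f₂
      f₂ := g₂
      f₃ := fr.f₃
      a_mem := fr.a_mem
      f₁_mem := fun i => (Fq p k).add_mem ((Fq p k).mul_mem (c 0).2 (fr.f₁_mem i))
        ((Fq p k).mul_mem (c 1).2 (fr.f₂_mem i))
      f₂_mem := hg₂
      f₃_mem := fr.f₃_mem
      alt_f₁ := hf
      alt_f₂ := e1
      alt_f₃ := fr.alt_f₃
      alt_f₁_f₂ := e2
      alt_f₁_f₃ := by
        rw [alt_add_left, alt_smul_left, alt_smul_left, fr.alt_f₁_f₃, fr.alt_f₂_f₃]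
        ring
      alt_f₂_f₃ := e3
      expand := fun b => by
        rw [add_assoc, e4 b, ← add_assoc]
        exact fr.expand b }
  refine ⟨fr', rfl, ?_⟩
  refine (eq_span_sup_of_covBy (z := liftSnd fr'.f₁) h ?_ ?_).trans rfl
  · rw [hX, lineOver, mem_span_sup_iff]
    refine ⟨1, liftSnd fr'.f₁ - lineVec fr.radBasis (fun i => c i), ?_, by rw [one_smul]; abel⟩
    rw [mem_map_F_M2]
    simp only [lineVec, radBasis, Fin.sum_univ_two, map_sub, map_add, LinearMap.map_smulₛₗ]
    constructor
    · simp
    · refine ⟨0, ?_⟩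
      simp only [redSnd_liftSnd, Matrix.cons_val_zero, Matrix.cons_val_one, zero_smul]
      exact sub_self _
  · intro h0
    obtain ⟨-, μ, h1⟩ := fr.mem_map_F_M2.mp h0
    have h2 := fr'.alt_f₁_f₂
    rw [redSnd_liftSnd] at h1
    rw [h1, alt_smul_left, show fr.s = fr'.s from rfl, fr'.alt_s_f₂, mul_zero] at h2
    exact zero_ne_one h2

/-- The plane of s and f₁ is Lagrangian, so it equals its own orthogonal complement. -/
theorem mem_L {z : M3 p k} :
    z ∈ fr.L ↔ redFst z = 0 ∧ alt fr.s (redSnd z) = 0 ∧ alt fr.f₁ (redSnd z) = 0 := by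
  rw [L, mem_span_sup_iff]
  constructor
  · rintro ⟨c, n, hn, rfl⟩
    obtain ⟨h1, μ, h2⟩ := fr.mem_map_F_M2.mp hn
    simp only [map_add, LinearMap.map_smulₛₗ, redFst_liftSnd, redSnd_liftSnd, h1, h2,
      alt_add_right, alt_smul_right, fr.alt_s_f₁, alt_self, fr.alt_f₁_s]
    simp
  · rintro ⟨h1, h2, h3⟩
    refine ⟨teichmuller p (alt (redSnd z) fr.f₂), z - teichmuller p (alt (redSnd z) fr.f₂) •
      liftSnd fr.f₁, ?_, by abel⟩
    rw [mem_map_F_M2]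
    simp only [map_sub, LinearMap.map_smulₛₗ, redFst_liftSnd, redSnd_liftSnd, h1]
    refine ⟨by simp, alt (redSnd z) fr.f₃, ?_⟩
    rw [sub_eq_iff_eq_add]
    conv_lhs => rw [fr.expand' (redSnd z)]
    rw [h2, h3, zero_smul, zero_smul, add_zero, add_zero]
    rfl

theorem f₁_notMem : liftSnd fr.f₁ ∉ fr.M2.map (F p k) := by
  intro h
  obtain ⟨-, μ, h1⟩ := fr.mem_map_F_M2.mp h
  have h2 := fr.alt_f₁_f₂
  rw [redSnd_liftSnd] at h1
  rw [h1, alt_smul_left, fr.alt_s_f₂, mul_zero] at h2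
  exact zero_ne_one h2

theorem covBy_L : fr.M2.map (F p k) ⋖ fr.L :=
  covBy_span_sup (fr.p_smul_mem_map_F_M2 _) fr.f₁_notMem

theorem map_Phi_L : fr.L.map (Phi p k) = fr.L :=
  map_Phi_sup_span (map_Phi_map_F fr.map_Phi_M2) (Phi_liftSnd fr.f₁_mem)

theorem L_le_rad : fr.L ≤ rad fr.M2 := fun _ hz =>
  fr.mem_rad.mpr ⟨(fr.mem_L.mp hz).1, (fr.mem_L.mp hz).2.1⟩

theorem relLength_M2_top : relLength p k fr.M2 ⊤ = 3 :=
  relLength_top_of_covBy' (m := 3) fr.FPow_covBy_M2 relLength_FPow_one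

theorem relLength_L_top : relLength p k fr.L ⊤ = 6 := by
  have h1 := relLength_add (fr.map_F_M2_le_rad.trans fr.rad_le_M2) le_top
  rw [fr.relLength_M2, fr.relLength_M2_top] at h1
  exact relLength_top_of_covBy' (m := 6) fr.covBy_L (h1.trans (by norm_num))

theorem FPow_two_le_map_F_M2 : FPow p k 2 ≤ fr.M2.map (F p k) := by
  intro z hz
  obtain ⟨y, rfl⟩ := mem_FPow_two.mp hz
  exact fr.p_smul_mem_map_F_M2 y

end Frame

/-- Integrality of the pairing on `F M₃`. -/
theorem pairing_mem_iff_of_mem_FPow_one {x y : M3 p k} (hx : x ∈ FPow p k 1)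
    (hy : y ∈ FPow p k 1) :
    pairing p k x y ∈ integers p k ↔ alt (redSnd x) (redSnd y) = 0 := by
  obtain ⟨a, ha⟩ := eq_p_smul fun i => congrFun (mem_FPow_one.mp hx) i
  obtain ⟨b, hb⟩ := eq_p_smul fun i => congrFun (mem_FPow_one.mp hy) i
  have h1 : pairing p k x y = algebraMap _ _ (alt a b) + algebraMap _ _ (alt x.2 y.2) / p := by
    rw [pairing, ha, hb, alt_smul_left, alt_smul_right, map_mul, map_mul, map_natCast]
    have := frac_p_ne_zero (p := p) (k := k)
    field_simp
  rw [h1, add_mem_cancel_left (algebraMap_mem_integers _), algebraMap_div_p_mem_iff,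
    coeff_zero_alt]
  rfl

/-! ### Self-duality of `L`, and rational choices of `M₁` and `M₀`. -/

namespace Frame

variable (fr : Frame p k)

/-- On `F M₃` integrality is orthogonality of the second reductions, and that of `L` is a Lagrangian
plane. Thus `L` lies in its dual, and equality follows because the colength 6 is half of 12. -/
theorem dual_L : dual p k fr.L = fr.L := by
  have hle : fr.L ≤ dual p k fr.L := by
    intro y hy x hx
    obtain ⟨hx1, hx2, hx3⟩ := fr.mem_L.mp hx
    obtain ⟨hy1, hy2, hy3⟩ := fr.mem_L.mp hy
    refine (pairing_mem_iff_of_mem_FPow_one (mem_FPow_one.mpr hx1) (mem_FPow_one.mpr hy1)).mpr ?_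
    rw [fr.expand' (redSnd x), hx2, hx3, zero_smul, zero_smul, add_zero, add_zero, alt_add_left,
      alt_smul_left, alt_smul_left, hy2, hy3]
    ring
  refine (eq_of_le_of_relLength_top hle (n := 6) fr.relLength_L_top ?_).symm
  exact relLength_dual (n := 6) (m := 6) ((FPow_anti (m := 2) (by norm_num)).trans
    (fr.FPow_two_le_map_F_M2.trans fr.covBy_L.le)) fr.relLength_L_top rfl

/-- Lifts of a basis of `M₂ / L`. -/
def quotBasis : Fin 3 → M3 p k := ![liftFst fr.a, liftSnd fr.f₃, liftSnd fr.f₂]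

theorem Phi_quotBasis (i : Fin 3) : Phi p k (fr.quotBasis i) = fr.quotBasis i := by
  fin_cases i
  · exact Phi_liftFst fr.a_mem
  · exact Phi_liftSnd fr.f₃_mem
  · exact Phi_liftSnd fr.f₂_mem

/-- The coordinates on `M₂ / L`. -/
def quotRed : M3 p k →ₛₗ[(constantCoeff : WittVector p k →+* k)] (Fin 3 → k) :=
  piRed ![altFst fr.g, altSnd fr.s, altSnd fr.f₁]

theorem quotRed_quotBasis (i : Fin 3) : fr.quotRed (fr.quotBasis i) = Pi.single i 1 := by
  ext j
  fin_cases i <;> fin_cases j <;>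
    simp [quotRed, quotBasis, piRed, altSnd, altFst, fr.alt_f₁_f₂, alt_zero_left, alt_zero_right,
      fr.alt_a_g, fr.alt_s_f₃, fr.alt_s_f₂, fr.alt_f₁_f₃]

theorem mem_L_iff_quotRed {z : M3 p k} (hz : z ∈ fr.M2) : z ∈ fr.L ↔ fr.quotRed z = 0 := by
  rw [mem_L]
  constructor
  · rintro ⟨h1, h2, h3⟩
    ext j
    fin_cases j <;> simp [quotRed, piRed, altFst, altSnd, h1, h2, h3, alt_zero_left]
  · intro h
    have h1 : alt (redFst z) fr.g = 0 := congrFun h 0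
    exact ⟨by rw [fr.mem_M2.mp hz, h1, zero_smul], congrFun h 1, congrFun h 2⟩

theorem L_le_M2 : fr.L ≤ fr.M2 := fr.L_le_rad.trans fr.rad_le_M2

theorem p_smul_mem_L (z : M3 p k) : (p : WittVector p k) • z ∈ fr.L :=
  fr.covBy_L.le (fr.p_smul_mem_map_F_M2 z)

theorem indepMod_quotBasis : IndepMod fr.quotBasis fr.L :=
  IndepMod.of_red fr.quotRed (fun _ hz => (fr.mem_L_iff_quotRed (fr.L_le_M2 hz)).mp hz)
    fr.quotRed_quotBasis fun _ => fr.p_smul_mem_L _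

theorem span_quotBasis : Submodule.span _ (Set.range fr.quotBasis) ⊔ fr.L = fr.M2 := by
  refine span_sup_eq_of_red fr.quotRed fr.L_le_M2 (fun z hz => (fr.mem_L_iff_quotRed hz).mpr) ?_
    fr.quotRed_quotBasis
  intro i
  fin_cases i
  · exact fr.mem_M2_of_eq_smul (μ := 1) (by simp [quotBasis])
  · exact fr.FPow_le_M2 (mem_FPow_one.mpr (redFst_liftSnd _))
  · exact fr.FPow_le_M2 (mem_FPow_one.mpr (redFst_liftSnd _))

theorem quotRed_lineVec (c : Fin 3 → k) : fr.quotRed (lineVec fr.quotBasis c) = c := by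
  ext i
  simp only [lineVec, map_sum, LinearMap.map_smulₛₗ, quotRed_quotBasis]
  exact eq_coeff_zero_of_sum_single c i

theorem lineVec_mem_M2 (c : Fin 3 → k) : lineVec fr.quotBasis c ∈ fr.M2 := by
  rw [← fr.span_quotBasis]
  exact lineOver_le c (Submodule.mem_sup_left (Submodule.mem_span_singleton_self _))

theorem altFst_lineVec (c : Fin 3 → k) : alt (redFst (lineVec fr.quotBasis c)) fr.g = c 0 :=
  congrFun (fr.quotRed_lineVec c) 0

theorem altSnd_lineVec (c : Fin 3 → k) : alt fr.s (redSnd (lineVec fr.quotBasis c)) = c 1 :=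
  congrFun (fr.quotRed_lineVec c) 1

/-- By `hForm_eq` the form sees only the coordinates c₀ and c₁, and these vanish on `L`. Hence it
suffices to test the generator on itself. -/
theorem FV_lineOver_iff (c : Fin 3 → k) :
    FV p k (lineOver fr.quotBasis fr.L c) ≤ dual p k (lineOver fr.quotBasis fr.L c) ↔
      c 0 * c 1 ^ p = c 0 ^ p * c 1 := by
  have hmem : lineOver fr.quotBasis fr.L c ≤ fr.M2 := by
    rw [← fr.span_quotBasis]
    exact lineOver_le c
  rw [FV_le_dual_iff]
  constructor
  · intro h
    have hv : lineVec fr.quotBasis c ∈ lineOver fr.quotBasis fr.L c :=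
      Submodule.mem_sup_left (Submodule.mem_span_singleton_self _)
    have := h _ hv _ hv
    rw [fr.hForm_eq (hmem hv) (hmem hv), altFst_lineVec, altSnd_lineVec] at this
    exact sub_eq_zero.mp this
  · intro h x hx y hy
    rw [fr.hForm_eq (hmem hx) (hmem hy)]
    obtain ⟨α, l, hl, rfl⟩ := mem_span_sup_iff.mp hx
    obtain ⟨β, l', hl', rfl⟩ := mem_span_sup_iff.mp hy
    obtain ⟨h1, h2, -⟩ := fr.mem_L.mp hl
    obtain ⟨h1', h2', -⟩ := fr.mem_L.mp hl'
    simp only [map_add, LinearMap.map_smulₛₗ, h1, h1', add_zero, alt_add_right, h2, h2',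
      alt_smul_left, alt_smul_right, altFst_lineVec, altSnd_lineVec, mul_pow]
    linear_combination (constantCoeff α * constantCoeff β ^ p) * h

theorem lineOver_le_iff {N : Lat p k} (hN : fr.L ≤ N) (c : Fin 3 → k) :
    lineOver fr.quotBasis fr.L c ≤ N ↔ lineVec fr.quotBasis c ∈ N := by
  rw [lineOver, sup_le_iff, Submodule.span_singleton_le_iff_mem, and_iff_left hN]

theorem lineOver_le_FPow_iff (c : Fin 3 → k) :
    lineOver fr.quotBasis fr.L c ≤ FPow p k 1 ↔ c 0 = 0 := by
  rw [fr.lineOver_le_iff (fr.L_le_rad.trans inf_le_left), mem_FPow_one]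
  have h := fr.mem_M2.mp (fr.lineVec_mem_M2 c)
  rw [altFst_lineVec] at h
  rw [h, smul_eq_zero, or_iff_left fr.a_ne_zero]

theorem lineOver_le_rad_iff (c : Fin 3 → k) :
    lineOver fr.quotBasis fr.L c ≤ rad fr.M2 ↔ c 0 = 0 ∧ c 1 = 0 := by
  rw [fr.lineOver_le_iff fr.L_le_rad, mem_rad, altSnd_lineVec]
  have h := fr.mem_M2.mp (fr.lineVec_mem_M2 c)
  rw [altFst_lineVec] at h
  rw [h, smul_eq_zero, or_iff_left fr.a_ne_zero]

end Frame

/-- The conditions on the module `M₁` of a flag in the closure of the rigid flags, for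
given `M₂` and `L`. -/
structure IsMiddle (M2 L M1 : Lat p k) : Prop where
  covBy : L ⋖ M1
  le : M1 ≤ M2
  map_Phi : M1.map (Phi p k) = M1
  FV_le : FV p k M1 ≤ dual p k M1
  -- This removes the isotropic modules with c₀ = 0 and c₁ ≠ 0, which are not limits of rigid flags.
  le_rad : M1 ≤ FPow p k 1 → M1 ≤ rad M2

namespace Frame

variable (fr : Frame p k)

theorem isMiddle_lineOver {c : Fin 3 → k} (hc : c ≠ 0) (hq : ∀ i, c i ∈ Fq p k)
    (h : c 0 * c 1 ^ p = c 0 ^ p * c 1) (h0 : c 0 = 0 → c 1 = 0) :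
    IsMiddle fr.M2 fr.L (lineOver fr.quotBasis fr.L c) where
  covBy := fr.indepMod_quotBasis.covBy_lineOver hc
  le := by
    rw [← fr.span_quotBasis]
    exact lineOver_le c
  map_Phi := map_Phi_lineOver fr.Phi_quotBasis fr.map_Phi_L hq
  FV_le := (fr.FV_lineOver_iff c).mpr h
  le_rad := by
    rw [lineOver_le_FPow_iff, lineOver_le_rad_iff]
    exact fun hc => ⟨hc, h0 hc⟩

theorem exists_lineOver_of_isMiddle {X : Lat p k} (h : IsMiddle fr.M2 fr.L X) :
    ∃ c : Fin 3 → k, c ≠ 0 ∧ (∀ i, c i ∈ Fq p k) ∧ c 0 * c 1 ^ p = c 0 ^ p * c 1 ∧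
      (c 0 = 0 → c 1 = 0) ∧ X = lineOver fr.quotBasis fr.L c := by
  obtain ⟨c, hc, rfl⟩ := fr.indepMod_quotBasis.exists_lineOver fr.Phi_quotBasis h.covBy
    (by rw [fr.span_quotBasis]; exact h.le) h.map_Phi
  refine ⟨_, fun h0 => hc (funext fun i => Subtype.ext (congrFun h0 i)), fun i => (c i).2,
    (fr.FV_lineOver_iff _).mp h.FV_le, fun h0 => ?_, rfl⟩
  exact ((fr.lineOver_le_rad_iff _).mp (h.le_rad ((fr.lineOver_le_FPow_iff _).mpr h0))).2

/-- The normalized coordinate vectors of the modules `M₁`. -/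
def middleVec : Option ({b : k | b ^ p ^ 1 = b} × Fq p k) → Fin 3 → k
  | none => ![0, 0, 1]
  | some (b, c) => ![1, b, c]

theorem middleVec_ne_zero (o : Option ({b : k | b ^ p ^ 1 = b} × Fq p k)) : middleVec o ≠ 0 := by
  rcases o with - | ⟨b, c⟩ <;> intro h
  · exact one_ne_zero (congrFun h 2)
  · exact one_ne_zero (congrFun h 0)

theorem isMiddle_middleVec (o : Option ({b : k | b ^ p ^ 1 = b} × Fq p k)) :
    IsMiddle fr.M2 fr.L (lineOver fr.quotBasis fr.L (middleVec o)) := by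
  have hp := (Fact.out : p.Prime).ne_zero
  refine fr.isMiddle_lineOver (middleVec_ne_zero o) ?_ ?_ ?_ <;> rcases o with - | ⟨b, c⟩
  · intro i
    fin_cases i
    exacts [zero_mem _, zero_mem _, one_mem _]
  · intro i
    have hb : (b : k) ^ p = b := by simpa using b.2
    fin_cases i
    · exact one_mem _
    · change ((b : k) ^ p ^ 2 = b)
      rw [← pow_p_pow_p, hb, hb]
    · exact c.2
  · simp [middleVec, hp]
  · have hb : (b : k) ^ p = b := by simpa using b.2
    simp [middleVec, hb]
  · intro _
    rfl
  · intro h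
    exact absurd h one_ne_zero

/-- With c₀ = 1 the isotropy equation is b^p = b while the last coordinate is free. With c₀ = 0 also
c₁ = 0, which leaves one point. -/
theorem ncard_M1 : {X : Lat p k | IsMiddle fr.M2 fr.L X}.ncard =
    Nat.card (Option ({b : k | b ^ p ^ 1 = b} × Fq p k)) := by
  rw [← Nat.card_coe_set_eq]
  refine (Nat.card_congr (Equiv.ofBijective
    (fun o => ⟨_, fr.isMiddle_middleVec o⟩) ⟨?_, ?_⟩)).symm
  · intro o o' h
    obtain ⟨μ, hμ⟩ := (fr.indepMod_quotBasis.lineOver_eq_iff (middleVec_ne_zero o')).mp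
      (congrArg Subtype.val h)
    have h0 := congrFun hμ 0
    have h1 := congrFun hμ 1
    have h2 := congrFun hμ 2
    rcases o with - | ⟨b, c⟩ <;> rcases o' with - | ⟨b', c'⟩ <;>
      simp [middleVec] at h0 h1 h2
    · rfl
    · rw [← h0] at h2
      simp at h2
    · subst h0
      rw [one_mul] at h1 h2
      rw [Subtype.ext h1, Subtype.ext h2]
  · rintro ⟨X, hX⟩
    obtain ⟨c, hc, hq, h, h0, rfl⟩ := fr.exists_lineOver_of_isMiddle hX
    by_cases hc0 : c 0 = 0
    · refine ⟨none, Subtype.ext ((fr.indepMod_quotBasis.lineOver_eq_iff hc).mpr ⟨c 2, ?_⟩)⟩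
      ext i
      fin_cases i <;> simp [middleVec, hc0, h0 hc0]
    · refine ⟨some (⟨c 1 / c 0, ?_⟩, ⟨c 2 / c 0, (Fq p k).div_mem (hq 2) (hq 0)⟩),
        Subtype.ext ((fr.indepMod_quotBasis.lineOver_eq_iff hc).mpr ⟨c 0, ?_⟩)⟩
      · change (c 1 / c 0) ^ p ^ 1 = c 1 / c 0
        rw [pow_one, div_pow, div_eq_div_iff (pow_ne_zero _ hc0) hc0]
        linear_combination h
      · ext i
        fin_cases i <;> simp [middleVec, mul_div_cancel₀, hc0]

/-- The number of modules `M₀`. -/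
theorem ncard_M0 [Finite (Fq p k)] {M1 : Lat p k} (h : IsMiddle fr.M2 fr.L M1) :
    {X : Lat p k | dual p k M1 ⋖ X ∧ X ≤ M1 ∧ X.map (Phi p k) = X}.ncard =
      ∑ i ∈ Finset.range 2, Nat.card (Fq p k) ^ i := by
  obtain ⟨c, hc, hq, hiso, h0, rfl⟩ := fr.exists_lineOver_of_isMiddle h
  set v := lineVec fr.quotBasis c with hv
  have hvΦ : Phi p k v = v := Phi_lineVec fr.Phi_quotBasis hq
  have hvL : v ∉ fr.L := fun hv => hc ((fr.indepMod_quotBasis.lineVec_mem_iff c).mp hv)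
  have hdual : ∀ y, y ∈ dual p k (lineOver fr.quotBasis fr.L c) ↔
      pairing p k v y ∈ integers p k ∧ y ∈ fr.L := by
    intro y
    rw [lineOver, mem_dual_span_sup, fr.dual_L]
  -- The plane `M₁ / M₁ᵗ` needs a second basis vector that is fixed by `Φ`. If c₀ = 0, the lift of
  -- f₁ pairs with v to a nonzero multiple of c₂ / p modulo W; otherwise p times the lift of g pairs
  -- to c₀ / p.
  obtain ⟨l, hl, hlΦ, hlv⟩ : ∃ l ∈ fr.L, Phi p k l = l ∧ pairing p k v l ∉ integers p k := by
    by_cases hc0 : c 0 = 0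
    · refine ⟨liftSnd fr.f₁, Submodule.mem_sup_left (Submodule.mem_span_singleton_self _),
        Phi_liftSnd fr.f₁_mem, fun hn => ?_⟩
      have hvF : v ∈ FPow p k 1 := by
        have h := fr.mem_M2.mp (fr.lineVec_mem_M2 c)
        rw [altFst_lineVec, hc0, zero_smul] at h
        exact mem_FPow_one.mpr h
      have h1 := (pairing_mem_iff_of_mem_FPow_one hvF
        (mem_FPow_one.mpr (redFst_liftSnd _))).mp hn
      rw [redSnd_liftSnd, alt_comm, neg_eq_zero] at h1
      have h2 : alt fr.f₁ (redSnd v) = c 2 := congrFun (fr.quotRed_lineVec c) 2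
      rw [h1] at h2
      apply hc
      ext i
      fin_cases i
      exacts [hc0, h0 hc0, h2.symm]
    · refine ⟨(p : WittVector p k) • liftFst fr.g, fr.p_smul_mem_L _, ?_, fun hn => ?_⟩
      · rw [Phi_smul, Phi_liftFst fr.g_mem, map_natCast, map_natCast]
      · rw [pairing_smul_right, ← pairing_smul_left, pairing_p_smul_left,
          add_mem_cancel_right (algebraMap_mem_integers _), algebraMap_div_p_mem_iff,
          coeff_zero_alt] at hn
        exact hc0 ((fr.altFst_lineVec c).symm.trans hn)
  have hlen := relLength_top_of_covBy' (m := 5) h.covBy fr.relLength_L_top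
  have hle3 : FPow p k 3 ≤ lineOver fr.quotBasis fr.L c :=
    ((FPow_anti (m := 2) (by norm_num)).trans
      (fr.FPow_two_le_map_F_M2.trans fr.covBy_L.le)).trans h.covBy.le
  have hlen' := relLength_dual (m := 7) hle3 hlen rfl
  have hcov : dual p k (lineOver fr.quotBasis fr.L c) ⋖ fr.L :=
    covBy_of_relLength_top (fun y hy => ((hdual y).mp hy).2) hlen' fr.relLength_L_top
  have hlM : l ∉ dual p k (lineOver fr.quotBasis fr.L c) := fun h => hlv ((hdual l).mp h).1
  have hpv : (p : WittVector p k) • v ∈ dual p k (lineOver fr.quotBasis fr.L c) := by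
    rw [hdual]
    refine ⟨?_, fr.p_smul_mem_L v⟩
    rw [pairing_smul_right, pairing_self, mul_zero]
    exact zero_mem _
  have hind : IndepMod ![v, l] (dual p k (lineOver fr.quotBasis fr.L c)) := by
    have hpl := p_smul_mem_of_covBy hcov hl
    refine ⟨fun i => ?_, fun b hb => ?_⟩
    · fin_cases i
      exacts [hpv, hpl]
    · rw [Fin.sum_univ_two] at hb
      change b 0 • v + b 1 • l ∈ _ at hb
      have h1 : b 0 • v ∈ fr.L := by
        have := fr.L.sub_mem (hcov.le hb) (fr.L.smul_mem (b 1) hl)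
        rwa [add_sub_cancel_right] at this
      have h2 := (smul_mem_iff_of_notMem (fr.p_smul_mem_L v) hvL).mp h1
      have h3 : b 1 • l ∈ dual p k (lineOver fr.quotBasis fr.L c) := by
        have := Submodule.sub_mem _ hb (smul_mem_of_coeff_zero hpv h2)
        rwa [add_sub_cancel_left] at this
      have h4 := (smul_mem_iff_of_notMem hpl hlM).mp h3
      intro i
      fin_cases i
      exacts [h2, h4]
  have hspan : Submodule.span _ (Set.range ![v, l]) ⊔ dual p k (lineOver fr.quotBasis fr.L c) =
      lineOver fr.quotBasis fr.L c := by
    rw [Matrix.range_cons, Matrix.range_cons, Matrix.range_empty, Set.union_empty,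
      Submodule.span_union, sup_assoc, ← eq_span_sup_of_covBy hcov hl hlM]
    rfl
  have := hind.ncard_covBy (fun i => by fin_cases i; exacts [hvΦ, hlΦ]) (map_Phi_dual h.map_Phi)
  rwa [hspan] at this

end Frame

end Perfect

/-! ### Lengths and inclusions forced on every flag. -/

section Perfect

variable [CharP k p] [PerfectRing k p]

namespace PolarizedFlag

variable (x : PolarizedFlag p k)

theorem le_zero_one : x.M 0 ≤ x.M 1 := x.le 0
theorem le_one_two : x.M 1 ≤ x.M 2 := x.le 1

theorem relLength_two : relLength p k (x.M 2) ⊤ = (3 : ℕ) := by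
  have h : relLength p k (x.M 2) (x.M 3) = _ := x.length_eq 2
  rw [← x.top, h]
  norm_num

theorem relLength_one : relLength p k (x.M 1) ⊤ = (5 : ℕ) := by
  have h : relLength p k (x.M 1) (x.M 2) = _ := x.length_eq 1
  rw [relLength_add x.le_one_two le_top, x.relLength_two, h]
  norm_num

theorem relLength_zero : relLength p k (x.M 0) ⊤ = (6 : ℕ) := by
  have h : relLength p k (x.M 0) (x.M 1) = _ := x.length_eq 0
  rw [relLength_add x.le_zero_one le_top, x.relLength_one, h]
  norm_num

theorem covBy_zero_one : x.M 0 ⋖ x.M 1 :=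
  covBy_of_relLength_top x.le_zero_one x.relLength_zero x.relLength_one

theorem map_F_le_FV (N : Lat p k) : N.map (F p k) ≤ FV p k N := le_sup_left

theorem FPow_one_le : FPow p k 1 ≤ x.M 2 := by
  have h : FV p k (x.M 3) ≤ x.M 2 := x.FV_le 2
  rw [x.top] at h
  exact (map_F_le_FV _).trans h

theorem FV_two_le : FV p k (x.M 2) ≤ x.M 1 := x.FV_le 1

theorem FV_one_le : FV p k (x.M 1) ≤ dual p k (x.M 1) := x.FV_pow_le 1

theorem FPow_two_le : FPow p k 2 ≤ x.M 1 := by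
  rw [FPow_succ]
  exact (Submodule.map_mono x.FPow_one_le).trans ((map_F_le_FV _).trans x.FV_two_le)

theorem FPow_three_le : FPow p k 3 ≤ x.M 0 := by
  have h : FV p k (x.M 1) ≤ x.M 0 := x.FV_le 0
  rw [FPow_succ]
  exact (Submodule.map_mono x.FPow_two_le).trans ((map_F_le_FV _).trans h)

theorem FPow_covBy : FPow p k 1 ⋖ x.M 2 :=
  covBy_of_relLength_top x.FPow_one_le relLength_FPow_one x.relLength_two

/-- The polarization condition for i = 0 is `M₀ ≤ M₀ᵗ`, and both sides have colength 6. -/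
theorem dual_zero : dual p k (x.M 0) = x.M 0 := by
  have h : x.M 0 ≤ dual p k (x.M 0) := x.FV_pow_le 0
  exact (eq_of_le_of_relLength_top h x.relLength_zero
    (relLength_dual x.FPow_three_le x.relLength_zero rfl)).symm

theorem dual_one_covBy : dual p k (x.M 1) ⋖ x.M 0 := by
  refine covBy_of_relLength_top ?_ (relLength_dual (m := 7)
    (x.FPow_three_le.trans x.le_zero_one) x.relLength_one rfl) x.relLength_zero
  exact (dual_anti x.le_zero_one).trans_eq x.dual_zero

end PolarizedFlag

namespace MarkedFlag

variable (x : MarkedFlag p k)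

theorem map_F_covBy_L : (x.M 2).map (F p k) ⋖ x.L :=
  (relLength_eq_one_iff x.map_le_L).mp x.length_L

theorem L_le_one : x.L ≤ x.M 1 := x.L_le.trans inf_le_left

theorem L_le_FPow : x.L ≤ FPow p k 1 := x.L_le.trans inf_le_right

variable {x}

theorem IsRational.exists_frame (hx : x.IsRational) : ∃ fr : Frame p k, x.M 2 = fr.M2 :=
  FlagType.exists_frame x.FPow_covBy (hx.1 2)

theorem IsRational.relLength_L (hx : x.IsRational) : relLength p k x.L ⊤ = (6 : ℕ) := by
  obtain ⟨fr, hfr⟩ := hx.exists_frame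
  have h1 := relLength_add (x.map_F_covBy_L.le.trans (x.L_le_one.trans x.le_one_two)) le_top
  rw [x.relLength_two, hfr, fr.relLength_M2] at h1
  refine relLength_top_of_covBy' (m := 6) x.map_F_covBy_L ?_
  rw [hfr, h1]
  norm_num

theorem IsRational.covBy_L (hx : x.IsRational) : x.L ⋖ x.M 1 :=
  covBy_of_relLength_top x.L_le_one hx.relLength_L x.relLength_one

/-- Each module covers the one that it is generated over, so any element of the difference serves.
Without a presentation, membership in `F0` would carry no information. -/
theorem IsRational.exists_presents (hx : x.IsRational) : ∃ b, Presents p k b x := by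
  obtain ⟨b0, h0, h0'⟩ := exists_mem_notMem_of_covBy x.FPow_covBy
  obtain ⟨b1, h1, h1'⟩ := exists_mem_notMem_of_covBy x.map_F_covBy_L
  obtain ⟨b2, h2, h2'⟩ := exists_mem_notMem_of_covBy hx.covBy_L
  obtain ⟨b3, h3, h3'⟩ := exists_mem_notMem_of_covBy x.dual_one_covBy
  exact ⟨![b0, b1, b2, b3], eq_span_sup_of_covBy x.FPow_covBy h0 h0',
    eq_span_sup_of_covBy x.map_F_covBy_L h1 h1', eq_span_sup_of_covBy hx.covBy_L h2 h2',
    eq_span_sup_of_covBy x.dual_one_covBy h3 h3'⟩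

end MarkedFlag

/-! ### Polynomial equations that hold on the closure. -/

namespace Presents

variable {x : MarkedFlag p k} {b : Fin 4 → M3 p k}

theorem mem_two (h : Presents p k b x) : b 0 ∈ x.M 2 := by
  rw [h.M_two]
  exact Submodule.mem_sup_left (Submodule.mem_span_singleton_self _)

theorem mem_L (h : Presents p k b x) : b 1 ∈ x.L := by
  rw [h.L_eq]
  exact Submodule.mem_sup_left (Submodule.mem_span_singleton_self _)

theorem mem_one (h : Presents p k b x) : b 2 ∈ x.M 1 := by
  rw [h.M_one]
  exact Submodule.mem_sup_left (Submodule.mem_span_singleton_self _)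

theorem mem_zero (h : Presents p k b x) : b 3 ∈ x.M 0 := by
  rw [h.M_zero]
  exact Submodule.mem_sup_left (Submodule.mem_span_singleton_self _)

theorem notMem_FPow (h : Presents p k b x) : b 0 ∉ FPow p k 1 := by
  intro hb
  apply x.FPow_covBy.lt.ne
  rw [h.M_two, eq_comm, sup_eq_right, Submodule.span_singleton_le_iff_mem]
  exact hb

theorem redFst_ne_zero (h : Presents p k b x) : redFst (b 0) ≠ 0 :=
  fun h' => h.notMem_FPow (mem_FPow_one.mpr h')

theorem redFst_two (h : Presents p k b x) : ∃ c : k, redFst (b 2) = c • redFst (b 0) := by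
  have h2 := x.le_one_two h.mem_one
  rw [h.M_two] at h2
  obtain ⟨c, n, hn, hc⟩ := mem_span_sup_iff.mp h2
  refine ⟨c.coeff 0, ?_⟩
  rw [hc, map_add, mem_FPow_one.mp hn, LinearMap.map_smulₛₗ, add_zero]
  rfl

/-- For a presentation of a rigid flag the generator `v` of `M₁` does not lie in `F M₃`. -/
theorem redFst_two_ne_zero (h : Presents p k b x) (hx : x.IsRigid) : redFst (b 2) ≠ 0 := by
  intro h0
  have h1 : x.M 1 ≤ FPow p k 1 := by
    rw [h.M_one]
    refine sup_le ?_ x.L_le_FPow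
    rw [Submodule.span_singleton_le_iff_mem]
    exact mem_FPow_one.mpr h0
  apply x.FPow_covBy.lt.ne
  have h2 : x.M 2 = x.M 0 ⊔ FPow p k 1 := hx 2
  rw [h2]
  exact (sup_eq_right.mpr (x.le_zero_one.trans h1)).symm

/-- Modulo `F M₃` the generator v of `M₁` is c times that of `M₂`, and the condition `hForm v w = 0`
is c times the equation. Rigidity makes c nonzero, so c cancels. -/
theorem rigid_eq_one (h : Presents p k b x) (hx : x.IsRigid) :
    alt (redFst (b 0)) (fun i => redSnd (b 1) i ^ p) = 0 := by
  obtain ⟨c, hc⟩ := h.redFst_two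
  have hc0 : c ≠ 0 := by
    rintro rfl
    exact h.redFst_two_ne_zero hx (by rw [hc, zero_smul])
  have h1 := FV_le_dual_iff.mp x.FV_one_le _ h.mem_one _ (x.L_le_one h.mem_L)
  have h2 : redFst (b 1) = 0 := mem_FPow_one.mp (x.L_le_FPow h.mem_L)
  have h3 : (fun i => redFst (b 1) i ^ p) = 0 := by
    rw [h2]
    exact funext fun i => zero_pow (Fact.out : p.Prime).ne_zero
  rw [hForm, h3, alt_zero_right, add_zero, hc, alt_smul_left] at h1
  exact (mul_eq_zero.mp h1).resolve_left hc0

/-- Dividing `hForm v v = 0` by c leaves a term with factor c^(p - 1). Multiplying by the power p -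
1 of a coordinate of `redFst (b 0)` absorbs it into that of `redFst (b 2)`, so the equation is
polynomial in the presentation. -/
theorem rigid_eq_two (h : Presents p k b x) (hx : x.IsRigid) (i : Fin 4) :
    redFst (b 0) i ^ (p - 1) * alt (redFst (b 0)) (fun i => redSnd (b 2) i ^ p) +
      redFst (b 2) i ^ (p - 1) * alt (redSnd (b 2)) (fun i => redFst (b 0) i ^ p) = 0 := by
  obtain ⟨c, hc⟩ := h.redFst_two
  have hc0 : c ≠ 0 := by
    rintro rfl
    exact h.redFst_two_ne_zero hx (by rw [hc, zero_smul])
  have h1 := FV_le_dual_iff.mp x.FV_one_le _ h.mem_one _ h.mem_one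
  have h3 : (fun i => redFst (b 2) i ^ p) = c ^ p • fun i => redFst (b 0) i ^ p := by
    rw [hc]
    exact funext fun i => mul_pow _ _ _
  rw [hForm, h3, hc, alt_smul_left, alt_smul_right] at h1
  have hp : c ^ p = c * c ^ (p - 1) :=
    (mul_pow_sub_one (Fact.out : p.Prime).ne_zero c).symm
  rw [hp, mul_assoc, ← mul_add] at h1
  have h4 := (mul_eq_zero.mp h1).resolve_left hc0
  rw [hc, Pi.smul_apply, smul_eq_mul, mul_pow]
  linear_combination redFst (b 0) i ^ (p - 1) * h4

end Presents

/-- The coordinates of a presentation. -/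
def presCoords (b : Fin 4 → M3 p k) : Fin 4 × (Fin 4 × Fin 3) → k :=
  fun ij => coords p k (b ij.1) ij.2

/-- A polynomial equation for the presentations of rigid flags holds for those of the closure. -/
theorem eval_eq_zero_of_mem_F0 {x : MarkedFlag p k} (hx : x ∈ F0 p k) {b : Fin 4 → M3 p k}
    (hb : Presents p k b x) (f : MvPolynomial (Fin 4 × (Fin 4 × Fin 3)) k)
    (hf : ∀ y : MarkedFlag p k, y.IsRigid → ∀ b', Presents p k b' y →
      MvPolynomial.eval (presCoords b') f = 0) : MvPolynomial.eval (presCoords b) f = 0 := by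
  have h1 := hx ⟨x, rfl, b, hb, rfl⟩
  refine h1 f ?_
  rintro _ ⟨y, hy, b', hb', rfl⟩
  exact hf y hy b' hb'

section Equations

open MvPolynomial

/-- The variable for the coordinate `i` of `redFst` of the `j`th generator. -/
def varFst (p : ℕ) [Fact p.Prime] (k : Type*) [Field k] (j : Fin 4) :
    Fin 4 → MvPolynomial (Fin 4 × (Fin 4 × Fin 3)) k :=
  fun i => X (j, (i, 0))

/-- The variable for the coordinate `i` of `redSnd` of the `j`th generator. -/
def varSnd (p : ℕ) [Fact p.Prime] (k : Type*) [Field k] (j : Fin 4) :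
    Fin 4 → MvPolynomial (Fin 4 × (Fin 4 × Fin 3)) k :=
  fun i => X (j, (i, 1))

theorem eval_varFst (b : Fin 4 → M3 p k) (i j : Fin 4) :
    eval (presCoords b) (varFst p k j i) = redFst (b j) i := by
  rw [varFst, eval_X]
  rfl

theorem eval_varSnd (b : Fin 4 → M3 p k) (i j : Fin 4) :
    eval (presCoords b) (varSnd p k j i) = redSnd (b j) i := by
  rw [varSnd, eval_X]
  rfl

theorem eq_one_of_mem_F0 {x : MarkedFlag p k} (hx : x ∈ F0 p k) {b : Fin 4 → M3 p k}
    (hb : Presents p k b x) : alt (redFst (b 0)) (fun i => redSnd (b 1) i ^ p) = 0 := by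
  have key : ∀ b : Fin 4 → M3 p k, eval (presCoords b)
      (alt (varFst p k 0) (fun i => varSnd p k 1 i ^ p)) =
        alt (redFst (b 0)) (fun i => redSnd (b 1) i ^ p) := by
    intro b
    simp only [map_alt, map_pow, eval_varFst, eval_varSnd]
  rw [← key]
  refine eval_eq_zero_of_mem_F0 hx hb _ fun y hy b' hb' => ?_
  rw [key]
  exact hb'.rigid_eq_one hy

theorem eq_two_of_mem_F0 {x : MarkedFlag p k} (hx : x ∈ F0 p k) {b : Fin 4 → M3 p k}
    (hb : Presents p k b x) (i : Fin 4) :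
    redFst (b 0) i ^ (p - 1) * alt (redFst (b 0)) (fun i => redSnd (b 2) i ^ p) +
      redFst (b 2) i ^ (p - 1) * alt (redSnd (b 2)) (fun i => redFst (b 0) i ^ p) = 0 := by
  have key : ∀ b : Fin 4 → M3 p k, eval (presCoords b)
      (varFst p k 0 i ^ (p - 1) * alt (varFst p k 0) (fun i => varSnd p k 2 i ^ p) +
        varFst p k 2 i ^ (p - 1) * alt (varSnd p k 2) (fun i => varFst p k 0 i ^ p)) =
      redFst (b 0) i ^ (p - 1) * alt (redFst (b 0)) (fun i => redSnd (b 2) i ^ p) +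
        redFst (b 2) i ^ (p - 1) * alt (redSnd (b 2)) (fun i => redFst (b 0) i ^ p) := by
    intro b
    simp only [map_add, map_mul, map_alt, map_pow, eval_varFst, eval_varSnd]
  rw [← key]
  refine eval_eq_zero_of_mem_F0 hx hb _ fun y hy b' hb' => ?_
  rw [key]
  exact hb'.rigid_eq_two hy i

end Equations

theorem Frame.mem_rad_of_alt_eq_zero (fr : Frame p k) {y z : M3 p k} (hy : y ∈ fr.M2)
    (hy0 : redFst y ≠ 0) (hz : redFst z = 0) (h : alt (redFst y) (fun i => redSnd z i ^ p) = 0) :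
    z ∈ rad fr.M2 := by
  refine fr.mem_rad.mpr ⟨hz, ?_⟩
  rw [fr.mem_M2.mp hy] at hy0
  rw [fr.mem_M2.mp hy, alt_smul_left, fr.alt_a_pow, mul_eq_zero,
    pow_eq_zero_iff (Fact.out : p.Prime).ne_zero] at h
  exact h.resolve_left fun h' => hy0 (by rw [h', zero_smul])

theorem MarkedFlag.IsRational.le_rad_of_mem_F0 {x : MarkedFlag p k} (hx : x.IsRational)
    (h : x ∈ F0 p k) : x.L ≤ rad (x.M 2) ∧ (x.M 1 ≤ FPow p k 1 → x.M 1 ≤ rad (x.M 2)) := by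
  obtain ⟨b, hb⟩ := hx.exists_presents
  obtain ⟨fr, hfr⟩ := hx.exists_frame
  have h0 : b 0 ∈ fr.M2 := hfr ▸ hb.mem_two
  have hL : x.L ≤ rad (x.M 2) := by
    rw [hb.L_eq, hfr]
    refine sup_le ?_ fr.map_F_M2_le_rad
    rw [Submodule.span_singleton_le_iff_mem]
    exact fr.mem_rad_of_alt_eq_zero h0 hb.redFst_ne_zero
      (mem_FPow_one.mp (x.L_le_FPow hb.mem_L)) (eq_one_of_mem_F0 h hb)
  refine ⟨hL, fun hM => ?_⟩
  rw [hb.M_one]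
  refine sup_le ?_ hL
  rw [Submodule.span_singleton_le_iff_mem, hfr]
  have h2 : redFst (b 2) = 0 := mem_FPow_one.mp (hM hb.mem_one)
  refine fr.mem_rad_of_alt_eq_zero h0 hb.redFst_ne_zero h2 ?_
  obtain ⟨i, hi⟩ := Function.ne_iff.mp hb.redFst_ne_zero
  have h3 := eq_two_of_mem_F0 h hb i
  -- The exponent is positive, so the second term of the equation vanishes with `redFst (b 2)`. The
  -- first term survives as a condition that `hForm` alone would not give.
  have hp : p - 1 ≠ 0 := Nat.sub_ne_zero_of_lt (Fact.out : p.Prime).one_lt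
  rw [h2, Pi.zero_apply, zero_pow hp, zero_mul, add_zero] at h3
  exact (mul_eq_zero.mp h3).resolve_left (pow_ne_zero _ hi)

/-! ### Deformation to rigid flags -/

theorem Frame.L_le_FPow (fr : Frame p k) : fr.L ≤ FPow p k 1 := fr.L_le_rad.trans inf_le_left

theorem FV_FPow (n : ℕ) : FV p k (FPow p k n) = FPow p k (n + 1) := by
  rw [FV_eq (map_Phi_FPow n), FPow_succ]

/-- `M0` is generated over the dual of `M1` by one vector, which is orthogonal to itself as the form
is alternating. -/
theorem le_dual_of_dual_covBy {M1 M0 : Lat p k} (hd0 : dual p k M1 ⋖ M0) (h01 : M0 ≤ M1) :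
    M0 ≤ dual p k M0 := by
  obtain ⟨u, hu, hu'⟩ := exists_mem_notMem_of_covBy hd0
  have hM0 := eq_span_sup_of_covBy hd0 hu hu'
  intro y hy x hx
  rw [hM0] at hx
  obtain ⟨α, d, hd, rfl⟩ := mem_span_sup_iff.mp hx
  refine pairing_add_mem' (pairing_smul_mem' ?_ α) (pairing_mem_comm (hd _ (h01 hy)))
  rw [hM0] at hy
  obtain ⟨β, d', hd', rfl⟩ := mem_span_sup_iff.mp hy
  refine pairing_add_mem (pairing_smul_mem ?_ β) (hd' u (h01 hu))
  rw [pairing_self]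
  exact zero_mem _

namespace Frame

variable (fr : Frame p k)

theorem FPow_two_le_L : FPow p k 2 ≤ fr.L := fr.FPow_two_le_map_F_M2.trans fr.covBy_L.le

theorem relLength_dual_top {M1 : Lat p k} (hL1 : fr.L ⋖ M1) :
    relLength p k (dual p k M1) ⊤ = (7 : ℕ) :=
  relLength_dual (((FPow_anti (by norm_num)).trans fr.FPow_two_le_L).trans hL1.le)
    (relLength_top_of_covBy' (m := 5) hL1 fr.relLength_L_top) rfl

/-- The marked flag with given `M₀` and `M₁`. -/
def flag {M1 M0 : Lat p k} (hL1 : fr.L ⋖ M1) (h12 : M1 ≤ fr.M2)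
    (hFV1 : FV p k M1 ≤ dual p k M1) (hd0 : dual p k M1 ⋖ M0) (h01 : M0 ≤ M1) :
    MarkedFlag p k where
  M := ![M0, M1, fr.M2, ⊤]
  top := rfl
  le i := by
    fin_cases i
    exacts [h01, h12, le_top]
  FV_le i := by
    fin_cases i
    -- Here the flag condition on `M1` follows from the polarization condition, because `M0`
    -- contains the dual of `M1`.
    · exact hFV1.trans hd0.le
    · change FV p k fr.M2 ≤ M1
      rw [FV_eq fr.map_Phi_M2]
      exact fr.covBy_L.le.trans hL1.le
    · exact (FV_FPow 0).le.trans fr.FPow_le_M2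
  length_eq i := by
    have hlen1 : relLength p k M1 ⊤ = (5 : ℕ) := relLength_top_of_covBy' hL1 fr.relLength_L_top
    fin_cases i
    · exact (relLength_of_top h01 (relLength_top_of_covBy' hd0 (fr.relLength_dual_top hL1)) hlen1
        rfl : _ = ((1 : ℕ) : ℕ∞)).trans (by norm_num)
    · exact (relLength_of_top h12 hlen1 fr.relLength_M2_top rfl : _ = ((2 : ℕ) : ℕ∞)).trans
        (by norm_num)
    · exact fr.relLength_M2_top.trans (by norm_num)
  FV_pow_le i := by
    fin_cases i
    · exact le_dual_of_dual_covBy hd0 h01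
    · exact hFV1
    · exact fr.FV_FV_M2_le
    · change FV p k (FV p k (FV p k (FPow p k 0))) ≤ dual p k ⊤
      rw [FV_FPow, FV_FPow, FV_FPow, dual_top]
  L := fr.L
  map_le_L := fr.covBy_L.le
  L_le := le_inf hL1.le fr.L_le_FPow
  length_L := (relLength_eq_one_iff fr.covBy_L.le).mpr fr.covBy_L

/-- If `F² M₃` were in `M0`, then `M0`, being isotropic, would lie in the dual `F M₃`, contrary to
u. So adding `F² M₃` enlarges `M0`, and adding u enlarges `F M₃`; as both steps of the flag are
coverings, the sums are `M1` and `M₂`. -/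
theorem isRigid_flag {M1 M0 : Lat p k} (hL1 : fr.L ⋖ M1) (h12 : M1 ≤ fr.M2)
    (hFV1 : FV p k M1 ≤ dual p k M1) (hd0 : dual p k M1 ⋖ M0) (h01 : M0 ≤ M1) {u : M3 p k}
    (hu : u ∈ M0) (hu' : u ∉ FPow p k 1) : (fr.flag hL1 h12 hFV1 hd0 h01).IsRigid := by
  have h01c : M0 ⋖ M1 := (fr.flag hL1 h12 hFV1 hd0 h01).covBy_zero_one
  intro i
  fin_cases i
  · refine (sup_eq_left.mpr ?_).symm
    exact (fr.flag hL1 h12 hFV1 hd0 h01).FPow_three_le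
  · change M1 = M0 ⊔ FPow p k 2
    rcases h01c.eq_or_eq le_sup_left (sup_le h01 (fr.FPow_two_le_L.trans hL1.le)) with h | h
    · exfalso
      have h2 : FPow p k 2 ≤ M0 := by
        rw [← h]
        exact le_sup_right
      have h3 := dual_anti h2 (le_dual_of_dual_covBy hd0 h01 hu)
      rw [dual_FPow_two] at h3
      exact hu' h3
    · exact h.symm
  · change fr.M2 = M0 ⊔ FPow p k 1
    rcases fr.FPow_covBy_M2.eq_or_eq (le_sup_right : FPow p k 1 ≤ M0 ⊔ FPow p k 1)
      (sup_le (h01.trans h12) fr.FPow_le_M2) with h | h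
    · exfalso
      apply hu'
      rw [← h]
      exact Submodule.mem_sup_left hu
    · exact h.symm
  · change (⊤ : Lat p k) = M0 ⊔ ⊤
    rw [sup_top_eq]

/-- Vectors `v ∈ M₂` and `u` outside `F M₃` complete `M₂` and `L` to a rigid flag. -/
theorem exists_rigid {v l u : M3 p k} {c : WittVector p k} (hv : v ∈ fr.M2)
    (hv' : v ∉ FPow p k 1) (hvv : hForm v v = 0) (hl : l ∈ fr.L) (hu : u = c • v + l)
    (hu' : u ∉ FPow p k 1) :
    ∃ y : MarkedFlag p k, y.IsRigid ∧ y.M 2 = fr.M2 ∧ y.L = fr.L ∧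
      y.M 1 = Submodule.span _ {v} ⊔ y.L ∧ y.M 0 = Submodule.span _ {u} ⊔ dual p k (y.M 1) := by
  set M1 : Lat p k := Submodule.span _ {v} ⊔ fr.L with hM1
  have hL1 : fr.L ⋖ M1 := covBy_span_sup (fr.p_smul_mem_L v) fun h => hv' (fr.L_le_FPow h)
  have h12 : M1 ≤ fr.M2 := sup_le ((Submodule.span_singleton_le_iff_mem _ _).mpr hv) fr.L_le_M2
  have hdL : dual p k M1 ≤ fr.L := (dual_anti hL1.le).trans_eq fr.dual_L
  have hu1 : u ∈ M1 := mem_span_sup_iff.mpr ⟨c, l, hl, hu⟩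
  have hLd : ∀ x ∈ fr.L, ∀ y ∈ fr.L, pairing p k x y ∈ integers p k := by
    intro x hx y hy
    rw [← fr.dual_L] at hy
    exact hy x hx
  have hpu : (p : WittVector p k) • u ∈ dual p k M1 := by
    rw [hM1, mem_dual_span_sup]
    refine ⟨?_, ?_⟩
    · rw [hu, smul_add]
      refine pairing_add_mem ?_ ?_
      · rw [pairing_smul_right, pairing_smul_right, pairing_self, mul_zero, mul_zero]
        exact zero_mem _
      · rw [pairing_smul_right, ← pairing_smul_left]
        exact hLd _ (fr.p_smul_mem_L v) _ hl
    · rw [fr.dual_L]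
      exact fr.p_smul_mem_L u
  have hd0 : dual p k M1 ⋖ Submodule.span _ {u} ⊔ dual p k M1 :=
    covBy_span_sup hpu fun h => hu' (fr.L_le_FPow (hdL h))
  have h01 : Submodule.span _ {u} ⊔ dual p k M1 ≤ M1 :=
    sup_le ((Submodule.span_singleton_le_iff_mem _ _).mpr hu1) (hdL.trans hL1.le)
  have hFV1 : FV p k M1 ≤ dual p k M1 := by
    rw [FV_le_dual_iff]
    intro x hx y hy
    rw [fr.hForm_eq hv hv] at hvv
    rw [fr.hForm_eq (h12 hx) (h12 hy)]
    obtain ⟨α, l, hl, rfl⟩ := mem_span_sup_iff.mp hx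
    obtain ⟨β, l', hl', rfl⟩ := mem_span_sup_iff.mp hy
    obtain ⟨h1, h2, -⟩ := fr.mem_L.mp hl
    obtain ⟨h1', h2', -⟩ := fr.mem_L.mp hl'
    simp only [map_add, LinearMap.map_smulₛₗ, h1, h1', add_zero, alt_add_right, h2, h2',
      alt_smul_left, alt_smul_right, mul_pow]
    linear_combination (constantCoeff α * constantCoeff β ^ p) * hvv
  exact ⟨fr.flag hL1 h12 hFV1 hd0 h01, fr.isRigid_flag hL1 h12 hFV1 hd0 h01
    (Submodule.mem_sup_left (Submodule.mem_span_singleton_self u)) hu', rfl, rfl, rfl, rfl⟩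

end Frame

end Perfect

/-! ### Polynomial curves -/

/-- Functions given by polynomials. -/
def IsPolyFun (g : k → k) : Prop := ∃ P : Polynomial k, ∀ t, g t = P.eval t

/-- Curves in the Witt vectors with polynomial components. -/
def IsWittPoly (z : k → WittVector p k) : Prop := ∀ n, IsPolyFun fun t => (z t).coeff n

theorem IsPolyFun.const (c : k) : IsPolyFun fun _ : k => c := ⟨Polynomial.C c, by simp⟩

theorem IsPolyFun.id : IsPolyFun fun t : k => t := ⟨Polynomial.X, by simp⟩

theorem IsPolyFun.aeval {R ι : Type*} [CommRing R] [Algebra R k] {g : ι → k → k}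
    (hg : ∀ i, IsPolyFun (g i)) (f : MvPolynomial ι R) :
    IsPolyFun fun t => MvPolynomial.aeval (fun i => g i t) f := by
  choose P hP using hg
  refine ⟨MvPolynomial.aeval P f, fun t => ?_⟩
  have h := MvPolynomial.comp_aeval_apply (R := R) (f := P)
    ((Polynomial.aeval t : Polynomial k →ₐ[k] k).restrictScalars R) f
  have h' : (fun i => g i t) = fun i =>
      ((Polynomial.aeval t : Polynomial k →ₐ[k] k).restrictScalars R) (P i) := by
    funext i
    rw [hP]
    rfl
  change MvPolynomial.aeval (fun i => g i t) f = _
  rw [h', ← h]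
  rfl

theorem IsWittPoly.const (c : WittVector p k) : IsWittPoly fun _ : k => c :=
  fun _ => IsPolyFun.const _

theorem IsWittPoly.teichmuller : IsWittPoly fun t : k => WittVector.teichmuller p t := by
  intro n
  rcases n with - | n
  · exact IsPolyFun.id
  · exact ⟨0, fun t => by simp [teichmuller_coeff_pos p t (n + 1) n.succ_pos]⟩

/-- Components of sums and products of Witt vectors are universal integral polynomials in the
components. -/
theorem IsWittPoly.peval {z w : k → WittVector p k} (hz : IsWittPoly z) (hw : IsWittPoly w)
    (f : MvPolynomial (Fin 2 × ℕ) ℤ) :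
    IsPolyFun fun t => WittVector.peval f ![(z t).coeff, (w t).coeff] := by
  refine IsPolyFun.aeval (R := ℤ) (g := fun i t => Function.uncurry ![(z t).coeff, (w t).coeff] i)
    ?_ f
  rintro ⟨i, n⟩
  fin_cases i
  exacts [hz n, hw n]

theorem IsWittPoly.add {z w : k → WittVector p k} (hz : IsWittPoly z) (hw : IsWittPoly w) :
    IsWittPoly fun t => z t + w t := by
  intro n
  simp only [add_coeff]
  exact hz.peval hw _

theorem IsWittPoly.mul {z w : k → WittVector p k} (hz : IsWittPoly z) (hw : IsWittPoly w) :
    IsWittPoly fun t => z t * w t := by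
  intro n
  simp only [mul_coeff]
  exact hz.peval hw _

/-- Curves in `M₃` with polynomial components. -/
def IsVecPoly (z : k → M3 p k) : Prop :=
  (∀ i, IsWittPoly fun t => (z t).1 i) ∧ ∀ i, IsWittPoly fun t => (z t).2 i

theorem IsVecPoly.const (z : M3 p k) : IsVecPoly fun _ : k => z :=
  ⟨fun _ => IsWittPoly.const _, fun _ => IsWittPoly.const _⟩

theorem IsVecPoly.add {z w : k → M3 p k} (hz : IsVecPoly z) (hw : IsVecPoly w) :
    IsVecPoly fun t => z t + w t :=
  ⟨fun i => (hz.1 i).add (hw.1 i), fun i => (hz.2 i).add (hw.2 i)⟩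

theorem IsVecPoly.smul {c : k → WittVector p k} {z : k → M3 p k} (hc : IsWittPoly c)
    (hz : IsVecPoly z) : IsVecPoly fun t => c t • z t :=
  ⟨fun i => hc.mul (hz.1 i), fun i => hc.mul (hz.2 i)⟩

theorem IsPolyFun.eq_zero [Infinite k] {g : k → k} (hg : IsPolyFun g) (S : Finset k)
    (h : ∀ t ∉ S, g t = 0) (t : k) : g t = 0 := by
  obtain ⟨P, hP⟩ := hg
  have : P = 0 := by
    refine Polynomial.eq_zero_of_infinite_isRoot P (S.finite_toSet.infinite_compl.mono ?_)
    intro t ht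
    rw [Set.mem_ofPred_eq, Polynomial.IsRoot, ← hP]
    exact h t ht
  rw [hP, this, Polynomial.eval_zero]

section Perfect

variable [CharP k p] [PerfectRing k p]

theorem IsVecPoly.presCoords {b : k → Fin 4 → M3 p k} (hb : ∀ j, IsVecPoly fun t => b t j)
    (ij : Fin 4 × (Fin 4 × Fin 3)) : IsPolyFun fun t => FlagType.presCoords (b t) ij := by
  obtain ⟨j, i, n⟩ := ij
  fin_cases n
  exacts [(hb j).1 i 0, (hb j).2 i 0, (hb j).1 i 1]

/-- Rational flags that satisfy the radical conditions are limits of rigid flags. -/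
theorem Frame.mem_F0 [Infinite k] (fr : Frame p k) {x : MarkedFlag p k} (h2 : x.M 2 = fr.M2)
    (hL : x.L = fr.L) (hrad : x.M 1 ≤ FPow p k 1 → x.M 1 ≤ rad fr.M2) : x ∈ F0 p k := by
  classical
  rintro _ ⟨y, hy, b, hb, rfl⟩ f hf
  obtain rfl : x = y := Eq.symm hy
  have hv : b 2 ∈ fr.M2 := h2 ▸ x.le_one_two hb.mem_one
  have hvv : hForm (b 2) (b 2) = 0 := FV_le_dual_iff.mp x.FV_one_le _ hb.mem_one _ hb.mem_one
  obtain ⟨c, l, hl, hu⟩ : ∃ c : WittVector p k, ∃ l ∈ fr.L, b 3 = c • b 2 + l := by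
    have := x.le_zero_one hb.mem_zero
    rw [hb.M_one, hL] at this
    exact mem_span_sup_iff.mp this
  -- The direction in which v is moved out of `F M₃`. If `M₁ ≤ F M₃`, it is the `xᵢ`-part of the
  -- generator of `M₂`: its second reduction is zero and v is in the radical, so isotropy persists.
  -- Otherwise v already lies outside and stays fixed.
  obtain ⟨e, he2, he⟩ : ∃ e ∈ fr.M2, ∀ t : k, t ≠ 0 →
      b 2 + teichmuller p t • e ∉ FPow p k 1 ∧
      hForm (b 2 + teichmuller p t • e) (b 2 + teichmuller p t • e) = 0 := by
    by_cases hM : x.M 1 ≤ FPow p k 1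
    · have hr := fr.mem_rad.mp (hrad hM hb.mem_one)
      have he : ((b 0).1, 0) ∈ fr.M2 := by
        have := h2 ▸ hb.mem_two
        rw [fr.mem_M2] at this ⊢
        exact this
      have hes : redSnd (((b 0).1, 0) : M3 p k) = 0 := funext fun _ => zero_coeff p k 0
      refine ⟨((b 0).1, 0), he, fun t ht => ⟨?_, ?_⟩⟩
      · rw [mem_FPow_one, map_add, LinearMap.map_smulₛₗ, hr.1, zero_add]
        exact smul_ne_zero ht hb.redFst_ne_zero
      · have hmem := fr.M2.add_mem hv (fr.M2.smul_mem (teichmuller p t) he)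
        rw [fr.hForm_eq hmem hmem, map_add redSnd, LinearMap.map_smulₛₗ redSnd, hes, smul_zero,
          add_zero, hr.2, zero_pow (Fact.out : p.Prime).ne_zero]
        ring
    · refine ⟨0, fr.M2.zero_mem, fun t _ => ?_⟩
      rw [smul_zero, add_zero]
      refine ⟨fun h => hM ?_, hvv⟩
      rw [hb.M_one]
      exact sup_le ((Submodule.span_singleton_le_iff_mem _ _).mpr h) x.L_le_FPow
  -- At t = 0 this is the given presentation. The perturbed factor c + [t] serves to move u out of
  -- `F M₃` as well.
  let B : k → Fin 4 → M3 p k := fun t => ![b 0, b 1, b 2 + teichmuller p t • e,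
    (c + teichmuller p t) • (b 2 + teichmuller p t • e) + l]
  have hB2 : IsVecPoly fun t : k => b 2 + teichmuller p t • e :=
    (IsVecPoly.const _).add (IsVecPoly.smul IsWittPoly.teichmuller (IsVecPoly.const _))
  have hBpoly : ∀ j, IsVecPoly fun t => B t j := by
    intro j
    fin_cases j
    · exact IsVecPoly.const _
    · exact IsVecPoly.const _
    · exact hB2
    · exact (IsVecPoly.smul ((IsWittPoly.const c).add IsWittPoly.teichmuller) hB2).add (IsVecPoly.const l)
  have hB0 : B 0 = b := by
    funext j
    fin_cases j
    · rfl
    · rfl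
    · simp [B]
    · simp [B, hu]
  have hpoly := IsPolyFun.aeval (R := k) (IsVecPoly.presCoords hBpoly) f
  -- Outside these two parameters v and c + [t] are both nonzero modulo `F M₃` and p respectively,
  -- so the flag is rigid.
  have hzero := hpoly.eq_zero {0, -c.coeff 0} ?_ 0
  · rw [hB0] at hzero
    exact hzero
  · intro t ht
    simp only [Finset.mem_insert, Finset.mem_singleton, not_or] at ht
    obtain ⟨hv1, hv2⟩ := he t ht.1
    have hu' : (c + teichmuller p t) • (b 2 + teichmuller p t • e) + l ∉ FPow p k 1 := by
      rw [mem_FPow_one, map_add, mem_FPow_one.mp (fr.L_le_FPow hl), add_zero,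
        LinearMap.map_smulₛₗ]
      refine smul_ne_zero ?_ fun h => hv1 (mem_FPow_one.mpr h)
      rw [map_add]
      exact fun h => ht.2 (eq_neg_of_add_eq_zero_right h)
    obtain ⟨y, hy, hy2, hyL, hy1, hy0⟩ := fr.exists_rigid
      (fr.M2.add_mem hv (fr.M2.smul_mem _ he2)) hv1 hv2 hl rfl hu'
    refine hf _ ⟨y, hy, B t, ⟨?_, ?_, hy1, hy0⟩, rfl⟩
    · rw [hy2, ← h2]
      exact hb.M_two
    · rw [hyL, ← hL, hy2, ← h2]
      exact hb.L_eq

end Perfect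

/-! ### Assembly of the count. -/

theorem ncard_pairs {α β : Type*} {P : Set α} {Q : α → Set β} {c : ℕ} (hP : P.Finite)
    (hc : c ≠ 0) (h : ∀ a ∈ P, (Q a).ncard = c) :
    {ab : α × β | ab.1 ∈ P ∧ ab.2 ∈ Q ab.1}.ncard = P.ncard * c := by
  have := hP.fintype
  -- Infinite sets have `ncard` zero, so the nonzero value c certifies that the fibres are finite.
  have hfin : ∀ a : P, Finite (Q a) := fun a =>
    (Set.finite_of_ncard_ne_zero (by rw [h a a.2]; exact hc)).to_subtype
  let e : {ab : α × β | ab.1 ∈ P ∧ ab.2 ∈ Q ab.1} ≃ Σ a : P, Q a :=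
    { toFun := fun ab => ⟨⟨ab.1.1, ab.2.1⟩, ⟨ab.1.2, ab.2.2⟩⟩
      invFun := fun ab => ⟨(ab.1.1, ab.2.1), ab.1.2, ab.2.2⟩ }
  rw [← Nat.card_coe_set_eq, Nat.card_congr e, Nat.card_sigma,
    Finset.sum_congr rfl fun (a : P) _ => (Nat.card_coe_set_eq (Q a)).trans (h a a.2),
    Finset.sum_const, smul_eq_mul, Finset.card_univ, ← Nat.card_eq_fintype_card,
    Nat.card_coe_set_eq]

variable [CharP k p]

section Perfect

variable [PerfectRing k p]

variable (p k) in
/-- The choices for `M₂`. -/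
def choicesTwo : Set (Lat p k) := {N | FPow p k 1 ⋖ N ∧ N.map (Phi p k) = N}

/-- The choices for `L` with given `M₂`. -/
def choicesL (M2 : Lat p k) : Set (Lat p k) :=
  {L | M2.map (F p k) ⋖ L ∧ L ≤ rad M2 ∧ L.map (Phi p k) = L}

/-- The choices for `M₀` with given `M₁`. -/
def choicesZero (M1 : Lat p k) : Set (Lat p k) :=
  {X | dual p k M1 ⋖ X ∧ X ≤ M1 ∧ X.map (Phi p k) = X}

variable (p k) in
/-- The choices for `(M₂, L)`. -/
def choicesTwoL : Set (Lat p k × Lat p k) := {ab | ab.1 ∈ choicesTwo p k ∧ ab.2 ∈ choicesL ab.1}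

variable (p k) in
/-- The choices for `((M₂, L), M₁)`. -/
def choicesOne : Set ((Lat p k × Lat p k) × Lat p k) :=
  {ab | ab.1 ∈ choicesTwoL p k ∧ ab.2 ∈ {X | IsMiddle ab.1.1 ab.1.2 X}}

variable (p k) in
/-- The choices for `(((M₂, L), M₁), M₀)`. -/
def choices : Set (((Lat p k × Lat p k) × Lat p k) × Lat p k) :=
  {ab | ab.1 ∈ choicesOne p k ∧ ab.2 ∈ choicesZero ab.1.2}

theorem exists_frame_of_mem {ab : Lat p k × Lat p k} (h : ab ∈ choicesTwoL p k) :
    ∃ fr : Frame p k, ab = (fr.M2, fr.L) := by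
  obtain ⟨M2, L⟩ := ab
  obtain ⟨h2, hL⟩ := h
  obtain ⟨fr, hfr⟩ := exists_frame h2.1 h2.2
  change M2 = fr.M2 at hfr
  subst hfr
  obtain ⟨fr', h1, h3⟩ := fr.exists_L hL.1 hL.2.1 hL.2.2
  exact ⟨fr', by rw [h1]; exact Prod.ext rfl h3⟩

/-- The modules of a marked flag. -/
def MarkedFlag.modules (x : MarkedFlag p k) : ((Lat p k × Lat p k) × Lat p k) × Lat p k :=
  (((x.M 2, x.L), x.M 1), x.M 0)

theorem MarkedFlag.modules_injective :
    Function.Injective (MarkedFlag.modules : MarkedFlag p k → _) := by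
  rintro ⟨⟨M, top, _, _, _, _⟩, L, _, _, _⟩ ⟨⟨M', top', _, _, _, _⟩, L', _, _, _⟩ h
  simp only [MarkedFlag.modules, Prod.mk.injEq] at h
  obtain ⟨⟨⟨h2, rfl⟩, h1⟩, h0⟩ := h
  have : M = M' := by
    funext i
    fin_cases i
    exacts [h0, h1, h2, top.trans top'.symm]
  subst this
  rfl

/-- The Zariski closure disappears from the problem here: on rational points it amounts to the two
radical conditions, necessary by the equations and sufficient by the deformation. -/
theorem image_modules [Infinite k] :
    MarkedFlag.modules '' {x : MarkedFlag p k | x ∈ F0 p k ∧ x.IsRational} = choices p k := by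
  ext τ
  constructor
  · rintro ⟨x, ⟨hx, hr⟩, rfl⟩
    obtain ⟨hL, h1⟩ := hr.le_rad_of_mem_F0 hx
    exact ⟨⟨⟨⟨x.FPow_covBy, hr.1 2⟩, x.map_F_covBy_L, hL, hr.2⟩,
      ⟨hr.covBy_L, x.le_one_two, hr.1 1, x.FV_one_le, h1⟩⟩,
      x.dual_one_covBy, x.le_zero_one, hr.1 0⟩
  · obtain ⟨⟨ab, M1⟩, M0⟩ := τ
    rintro ⟨⟨hab, h1⟩, h0⟩
    obtain ⟨fr, hfr⟩ := exists_frame_of_mem hab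
    change ab = _ at hfr
    subst hfr
    have h1' : IsMiddle fr.M2 fr.L M1 := h1
    refine ⟨fr.flag h1'.covBy h1'.le h1'.FV_le h0.1 h0.2.1,
      ⟨fr.mem_F0 rfl rfl h1'.le_rad, ?_, fr.map_Phi_L⟩, rfl⟩
    intro i
    fin_cases i
    exacts [h0.2.2, h1'.map_Phi, fr.map_Phi_M2, map_Phi_FPow 0]

end Perfect

section Count

variable [IsAlgClosed k]

theorem ncard_choices :
    (choices p k).ncard = (p ^ 2 + 1) ^ 3 * (p ^ 3 + 1) * (p ^ 4 + 1) := by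
  have hp := (Fact.out : p.Prime).pos
  have h1 : (choicesTwo p k).ncard = (p ^ 2 + 1) * (p ^ 4 + 1) := by
    refine ncard_M2.trans ?_
    simp only [card_Fq, Finset.sum_range_succ, Finset.sum_range_zero]
    ring
  have h2 : (choicesTwoL p k).ncard = (choicesTwo p k).ncard * (p ^ 2 + 1) := by
    refine ncard_pairs (Set.finite_of_ncard_ne_zero ?_) (by positivity) fun M2 hM2 => ?_
    · rw [h1]
      positivity
    · obtain ⟨fr, rfl⟩ := exists_frame hM2.1 hM2.2
      refine fr.ncard_L.trans ?_
      simp only [card_Fq, Finset.sum_range_succ, Finset.sum_range_zero]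
      ring
  have h3 : (choicesOne p k).ncard = (choicesTwoL p k).ncard * (p ^ 3 + 1) := by
    refine ncard_pairs (P := choicesTwoL p k) (Q := fun ab => {X | IsMiddle ab.1 ab.2 X})
      (c := p ^ 3 + 1) (Set.finite_of_ncard_ne_zero ?_) (by positivity) fun ab hab => ?_
    · rw [h2, h1]
      positivity
    · obtain ⟨fr, rfl⟩ := exists_frame_of_mem hab
      have hfin : {b : k | b ^ p ^ 1 = b}.Finite := by
        refine Set.finite_of_ncard_ne_zero ?_
        rw [ncard_pow_eq 1 one_ne_zero]
        positivity
      have := hfin.to_subtype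
      refine fr.ncard_M1.trans ?_
      rw [Finite.card_option, Nat.card_prod, Nat.card_coe_set_eq, ncard_pow_eq 1 one_ne_zero,
        card_Fq]
      ring
  have h4 : (choices p k).ncard = (choicesOne p k).ncard * (p ^ 2 + 1) := by
    refine ncard_pairs (P := choicesOne p k) (Q := fun ab => choicesZero ab.2)
      (c := p ^ 2 + 1) (Set.finite_of_ncard_ne_zero ?_) (by positivity) fun ab hab => ?_
    · rw [h3, h2, h1]
      positivity
    · obtain ⟨fr, hfr⟩ := exists_frame_of_mem hab.1
      have hm : IsMiddle fr.M2 fr.L ab.2 := by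
        have := hab.2
        rw [hfr] at this
        exact this
      refine (fr.ncard_M0 hm).trans ?_
      simp only [card_Fq, Finset.sum_range_succ, Finset.sum_range_zero]
      ring
  rw [h4, h3, h2, h1]
  ring

theorem ncard_F0_rational :
    {x : MarkedFlag p k | x ∈ F0 p k ∧ x.IsRational}.ncard =
      (p ^ 2 + 1) ^ 3 * (p ^ 3 + 1) * (p ^ 4 + 1) := by
  rw [← Set.ncard_image_of_injective _ MarkedFlag.modules_injective, image_modules, ncard_choices]

end Count

end FlagType

end

theorem mainTheorem9 (p : ℕ) [Fact p.Prime] (k : Type*) [Field k] [CharP k p] [IsAlgClosed k] :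
    {x : FlagType.MarkedFlag p k | x ∈ FlagType.F0 p k ∧ x.IsRational}.ncard =
      (p ^ 2 + 1) ^ 3 * (p ^ 3 + 1) * (p ^ 4 + 1) :=
  FlagType.ncard_F0_rational
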